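/- **Setting.** Let $d,m\ge 1$ and $n\ge 0$ be integers with $2(m+1)>d$, let $\max\{2,d\}<q\le\infty$, with $q\le 2d$ if $d-2m=1$, and let $\Omega\subset\mathbb R^d$ be open and bounded. Let $\phi\in W^{1,2}(\Omega,\mathbb R^n)$, $W^{1,2}_\phi=\phi+W^{1,2}_0(\Omega,\mathbb R^n)$, and let $H\subset W^{1,2}_\phi$ be convex and relatively open (for instance $H=W^{1,2}_\phi$). Variations of $\mathfrak J:H\to\mathbb R$ are Fréchet derivatives in directions of $W^{1,2}_0$. *Energy.* $\mathfrak J$ is $W^{1,2}$-elliptic: it is $C^2$ and, for all $v\in H$ and $V,W\in W_0^{1,2}$, $\lambda\|V\|_{W^{1,2}}^2\le\delta^2\mathfrak J(v)(V,V)$ and $|\delta^2\mathfrak J(v)(V,W)|\le\Lambda\|V\|_{W^{1,2}}\|W\|_{W^{1,2}}$, with $\lambda,\Lambda>0$. It is predominantly quadratic with respect to $q$: it is $C^3$, and there are a function $K$ and either $(o,r)=(1,2)$ or $o=0$ and $1\le r\le d$ such that $$|\delta^3\mathfrak J(v)(U,V,V)|\le K(R)\,\|U\|_{W^{2,2}}\|V\|_{W^{1,2}}\|V\|_{W^{o,r}}$$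 for all $R\ge0$, $v\in H\cap W^{1,q}$ with $\|v\|_{W^{1,q}}\le R$, $U\in W^{2,2}\cap W_0^{1,2}$, $V\in W^{1,2}_0\cap W^{o,r}$. *Discretization.* Let $0<h\le h_0$, and let $G$ be a partition (up to a null set) of $\Omega$ into finitely many open elements $T_h$, of width $h$ and order $m$: each element has a $C^\infty$-diffeomorphism $F_h:T_h\to T$ onto a fixed reference element with $c\,h^{-d}\le\|\det DF_h\|_{L^\infty}\le C h^{-d}$, $\|\partial_\alpha F_h\|_{L^\infty}\le Ch^{-1}$ and $|F_h^{-1}|_{W^{k,\infty}}\le Ch^k$ for $0\le k\le m$. Let $A\subset W^{1,2}_\phi\cap C(\Omega,\mathbb R^n)$ be a finite-dimensional affine space with direction $S^m_{h;0}$, and let $S^m_{h;\phi}=A\cap H$. Assume: (i) (Approximation, for the pair $(\phi,A)$ and for $(0,S^m_{h;0})$ in place of $(\phi,A)$.) Let $1\le k\le m+1$ and $1\le p<\infty$ with either $kp>d$ or $k=p=2$. Every $v\in W^{k,p}\cap W^{1,2}_\phi$ has an approximation $v_I\in A$ with $$\|v-v_I\|_{L^p}+h|v-v_I|_{W^{1,p}}\le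 C h^k|v|_{W^{k,p}},\qquad |v_I|_{W^{l,s}}\le C|v|_{W^{l,s}}$$ for all integers $1\le l\le k$ with $l=1$ or $l\ge k-\frac dp$, and all $1\le s\le\infty$ with $s\le \frac{pd}{d-p(k-l)}$ if $p(k-l)<d$; seminorms of $v_I$ are taken elementwise on $G$. The constants may depend on $k,p,l,s$. (ii) (Inverse estimate.) $\|v_h\|_{W^{1,s}}\le C h^{-d\max\{0,\frac1t-\frac1s\}}\|v_h\|_{W^{1,t}}$ for all $v_h\in S^m_{h;0}$ and $s,t\in[1,\infty]$, with a constant that may depend on $s,t$. **Theorem.** Let $u\in H\cap W^{m+1,2}(\Omega,\mathbb R^n)$ be a minimizer of $\mathfrak J$ in $H$, and let $u_h$ be a local minimizer of $\mathfrak J$ in $S^m_{h;\phi}$ that satisfies $$\|u-u_h\|_{W^{1,2}}\le C_1h^m|u|_{W^{m+1,2}}.$$ Suppose that the solution $W\in W^{1,2}_0$ of the adjoint problem $\delta^2\mathfrak J(u)(W,V)=-(V,u_h-u)_{L^2}$ for all $V\in W^{1,2}_0$ satisfies $\|W\|_{W^{2,2}}\le C_2\|u-u_h\|_{L^2}$.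 Then $$\|u-u_h\|_{L^2}\le C\,h^{m+1},$$ where $C$ depends only on upper bounds for $\|u\|_{W^{1,q}}$ and $|u|_{W^{m+1,2}}$, on $d,n,m,q,\Omega,h_0,\lambda,\Lambda,K,C_1,C_2$, and on the reference element and the constants of $G$, (i) and (ii). In particular, $C$ does not depend on $h$, $G$, $A$ or $u_h$. -/

import Mathlib

open MeasureTheory Set Topology
open scoped NNReal ENNReal ContDiff

noncomputable section

namespace SemilinearFEM

/-- Euclidean space of dimension `d`. -/
abbrev E (d : ℕ) : Type := EuclideanSpace ℝ (Fin d)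

/-! ### Weak derivatives and Sobolev (semi)norms -/

/-- Scalar test functions on `Ω`: smooth, with compact support inside `Ω`. -/
def IsTestFunction {d : ℕ} (Ω : Set (E d)) (η : E d → ℝ) : Prop :=
  ContDiff ℝ ∞ η ∧ HasCompactSupport η ∧ tsupport η ⊆ Ω

/-- The iterated partial derivative `∂_{α 0} ⋯ ∂_{α (k-1)} η` at `x`. -/
def partialDeriv {d k : ℕ} (α : Fin k → Fin d) (η : E d → ℝ) (x : E d) : ℝ :=
  iteratedFDeriv ℝ k η x (fun j => EuclideanSpace.single (α j) (1 : ℝ))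

/-- On `Ω`, the function `g` is the weak derivative `∂_{α 0} ⋯ ∂_{α (k-1)} f`. -/
structure HasWeakDeriv {d n k : ℕ} (Ω : Set (E d)) (α : Fin k → Fin d)
    (f g : E d → E n) : Prop where
  locInt : LocallyIntegrableOn f Ω
  locInt_deriv : LocallyIntegrableOn g Ω
  integral_eq : ∀ η : E d → ℝ, IsTestFunction Ω η →
    ∫ x in Ω, partialDeriv α η x • f x = (-1 : ℝ) ^ k • ∫ x in Ω, η x • g x

/-- The grid-dependent Sobolev seminorm
`|f|_{W^{k,p}(Ω)} = (∑_{T ∈ G} ∫_T |D^k f|^p)^{1/p}` (a maximum over the elements if `p = ∞`).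
Here `D^k f` is the array of all weak derivatives of order `k`, taken on each `T ∈ G` separately,
with its Euclidean norm.  The value is `∞` if these derivatives do not exist or are not in `L^p`. -/
def gridSeminorm {d n : ℕ} (Ω : Set (E d)) (G : Set (Set (E d))) (k : ℕ) (p : ℝ≥0∞)
    (f : E d → E n) : ℝ≥0∞ :=
  ⨅ (g : (Fin k → Fin d) → E d → E n) (_ : ∀ α, ∀ T ∈ G, HasWeakDeriv T α f (g α)),
    eLpNorm (fun x => WithLp.toLp 2 (fun α => g α x) : E d → PiLp 2 (fun _ => E n)) p
      (volume.restrict Ω)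

/-- The Sobolev seminorm `|f|_{W^{k,p}(Ω)}`. -/
def sobolevSeminorm {d n : ℕ} (Ω : Set (E d)) (k : ℕ) (p : ℝ≥0∞) (f : E d → E n) : ℝ≥0∞ :=
  gridSeminorm Ω {Ω} k p f

/-- The Sobolev norm `‖f‖_{W^{k,p}(Ω)}`; it is finite exactly if `f ∈ W^{k,p}(Ω)`. -/
def sobolevNorm {d n : ℕ} (Ω : Set (E d)) (k : ℕ) (p : ℝ≥0∞) (f : E d → E n) : ℝ≥0∞ :=
  ∑ l ∈ Finset.range (k + 1), sobolevSeminorm Ω l p f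

section Helpers

variable {d n k : ℕ} {Ω : Set (E d)}

theorem integrable_smul_of_locallyIntegrableOn {η : E d → ℝ} {f : E d → E n}
    (hc : Continuous η) (hs : HasCompactSupport η) (hsub : tsupport η ⊆ Ω)
    (hf : LocallyIntegrableOn f Ω) : Integrable (fun x => η x • f x) (volume.restrict Ω) := by
  have hK : IntegrableOn f (tsupport η) := hf.integrableOn_compact_subset hsub hs
  have h1 : IntegrableOn (fun x => η x • f x) (tsupport η) :=
    hK.continuousOn_smul hc.continuousOn hs
  have h2 : Integrable (fun x => η x • f x) := by
    refine (integrableOn_iff_integrable_of_support_subset ?_).1 h1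
    intro x hx
    apply subset_tsupport η
    intro h0
    exact hx (by simp [h0])
  exact h2.restrict

theorem integrable_partialDeriv_smul {η : E d → ℝ} {f : E d → E n} (α : Fin k → Fin d)
    (hη : IsTestFunction Ω η) (hf : LocallyIntegrableOn f Ω) :
    Integrable (fun x => partialDeriv α η x • f x) (volume.restrict Ω) := by
  have hts : tsupport (partialDeriv α η) ⊆ tsupport η := by
    refine closure_minimal (fun x hx => ?_) (isClosed_tsupport η)
    by_contra hxn
    have : iteratedFDeriv ℝ k η x = 0 := by
      have := support_iteratedFDeriv_subset (𝕜 := ℝ) (f := η) k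
      by_contra h0
      exact hxn (this h0)
    exact hx (by simp [partialDeriv, this])
  refine integrable_smul_of_locallyIntegrableOn ?_ ?_ (hts.trans hη.2.2) hf
  · have hcont : Continuous (iteratedFDeriv ℝ k η) :=
      hη.1.continuous_iteratedFDeriv (m := k) (by exact_mod_cast le_top)
    exact (ContinuousMultilinearMap.apply ℝ (fun _ : Fin k => E d) ℝ
      (fun j => EuclideanSpace.single (α j) (1 : ℝ))).continuous.comp hcont
  · exact hη.2.1.of_isClosed_subset (isClosed_tsupport _) hts

theorem HasWeakDeriv.zero (α : Fin k → Fin d) :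
    HasWeakDeriv Ω α (0 : E d → E n) 0 where
  locInt := locallyIntegrableOn_zero
  locInt_deriv := locallyIntegrableOn_zero
  integral_eq := by intro η _; simp

theorem HasWeakDeriv.add {α : Fin k → Fin d} {f g f' g' : E d → E n}
    (h : HasWeakDeriv Ω α f g) (h' : HasWeakDeriv Ω α f' g') :
    HasWeakDeriv Ω α (f + f') (g + g') where
  locInt := h.locInt.add h'.locInt
  locInt_deriv := h.locInt_deriv.add h'.locInt_deriv
  integral_eq := by
    intro η hη
    simp only [Pi.add_apply, smul_add]
    rw [integral_add (integrable_partialDeriv_smul α hη h.locInt)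
        (integrable_partialDeriv_smul α hη h'.locInt),
      integral_add
        (integrable_smul_of_locallyIntegrableOn hη.1.continuous hη.2.1 hη.2.2 h.locInt_deriv)
        (integrable_smul_of_locallyIntegrableOn hη.1.continuous hη.2.1 hη.2.2 h'.locInt_deriv),
      h.integral_eq η hη, h'.integral_eq η hη, smul_add]

theorem HasWeakDeriv.const_smul {α : Fin k → Fin d} {f g : E d → E n}
    (h : HasWeakDeriv Ω α f g) (c : ℝ) : HasWeakDeriv Ω α (c • f) (c • g) where
  locInt := h.locInt.smul c
  locInt_deriv := h.locInt_deriv.smul c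
  integral_eq := by
    intro η hη
    have e1 : ∀ x, partialDeriv α η x • (c • f) x = c • (partialDeriv α η x • f x) :=
      fun x => smul_comm (partialDeriv α η x) c (f x)
    have e2 : ∀ x, η x • (c • g) x = c • (η x • g x) := fun x => smul_comm (η x) c (g x)
    simp only [e1, e2, integral_smul]
    rw [h.integral_eq η hη, smul_comm]

theorem locallyIntegrableOn_congr_ae {f g : E d → E n} (h : f =ᵐ[volume.restrict Ω] g)
    (hf : LocallyIntegrableOn f Ω) : LocallyIntegrableOn g Ω := hf.congr h

theorem HasWeakDeriv.congr {α : Fin k → Fin d} {f g f' g' : E d → E n}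
    (h : HasWeakDeriv Ω α f g) (hf : f =ᵐ[volume.restrict Ω] f')
    (hg : g =ᵐ[volume.restrict Ω] g') : HasWeakDeriv Ω α f' g' where
  locInt := locallyIntegrableOn_congr_ae hf h.locInt
  locInt_deriv := locallyIntegrableOn_congr_ae hg h.locInt_deriv
  integral_eq := by
    intro η hη
    have e1 : ∫ x in Ω, partialDeriv α η x • f' x = ∫ x in Ω, partialDeriv α η x • f x :=
      integral_congr_ae (hf.mono fun x hx => congrArg (partialDeriv α η x • ·) hx.symm)
    have e2 : ∫ x in Ω, η x • g' x = ∫ x in Ω, η x • g x :=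
      integral_congr_ae (hg.mono fun x hx => congrArg (η x • ·) hx.symm)
    rw [e1, e2]
    exact h.integral_eq η hη

end Helpers

/-! ### The Hilbert spaces `W^{1,2}(Ω, ℝⁿ)` and `W₀^{1,2}(Ω, ℝⁿ)` -/

/-- The space `W^{1,2}(Ω, ℝⁿ)`.  An element is a function in `L²` (component `none`) together with
its weak partial derivatives `∂ᵢ`, which are in `L²` (component `some i`).  The norm is
`‖u‖² = ‖u‖²_{L²} + ∑ᵢ ‖∂ᵢ u‖²_{L²}`. -/
def W12 {d : ℕ} (Ω : Set (E d)) (n : ℕ) :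
    Submodule ℝ (PiLp 2 (fun _ : Option (Fin d) => Lp (E n) 2 (volume.restrict Ω))) where
  carrier := {F | ∀ i : Fin d, HasWeakDeriv Ω (fun _ : Fin 1 => i) (F none) (F (some i))}
  zero_mem' := fun _ => (HasWeakDeriv.zero _).congr (Lp.coeFn_zero _ _ _).symm
    (Lp.coeFn_zero _ _ _).symm
  add_mem' := fun {F F'} h h' i => ((h i).add (h' i)).congr
    (Lp.coeFn_add (F none) (F' none)).symm (Lp.coeFn_add (F (some i)) (F' (some i))).symm
  smul_mem' := fun c F h i => ((h i).const_smul c).congr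
    (Lp.coeFn_smul c (F none)).symm (Lp.coeFn_smul c (F (some i))).symm

/-- The `L²` function underlying an element of `W^{1,2}`. -/
def toL2 {d n : ℕ} {Ω : Set (E d)} (u : W12 Ω n) : Lp (E n) 2 (volume.restrict Ω) :=
  u.1 none

/-- A representative of an element of `W^{1,2}`. -/
def toFun {d n : ℕ} {Ω : Set (E d)} (u : W12 Ω n) : E d → E n := toL2 u

/-- The space `W₀^{1,2}(Ω, ℝⁿ)`: the closure in `W^{1,2}` of the smooth functions with compact
support in `Ω`. -/
def W012 {d : ℕ} (Ω : Set (E d)) (n : ℕ) : Submodule ℝ (W12 Ω n) :=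
  (Submodule.span ℝ {u : W12 Ω n | ∃ η : E d → E n, ContDiff ℝ ∞ η ∧ HasCompactSupport η ∧
    tsupport η ⊆ Ω ∧ toFun u =ᵐ[volume.restrict Ω] η}).topologicalClosure

/-- The affine space `W_φ^{1,2}` of the functions with the boundary values of `φ`. -/
def WBdry {d n : ℕ} {Ω : Set (E d)} (φ : W12 Ω n) : Set (W12 Ω n) :=
  {v | v - φ ∈ W012 Ω n}

/-- `H ⊆ W_φ^{1,2}` is an admissible domain for the minimization: convex, and (relatively) open in
`W_φ^{1,2}`, so that variations in all directions of `W₀^{1,2}` make sense.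
The main example is `H = W_φ^{1,2}`. -/
structure IsAdmissible {d n : ℕ} {Ω : Set (E d)} (φ : W12 Ω n) (H : Set (W12 Ω n)) : Prop where
  exists_open : ∃ O : Set (W12 Ω n), IsOpen O ∧ H = O ∩ WBdry φ
  convex : Convex ℝ H

/-! ### Energies -/

section Energies

variable {d n : ℕ} {Ω : Set (E d)}

/-- `J : H → ℝ` is `k` times continuously differentiable (with respect to the `W^{1,2}` norm and
directions in `W₀^{1,2}`); to be used for admissible `H`. -/
def IsCk (k : ℕ) (J : W12 Ω n → ℝ) (H : Set (W12 Ω n)) : Prop :=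
  ∀ v ∈ H, ContDiffAt ℝ k (fun V : W012 Ω n => J (v + V)) 0

/-- The second variation `δ²J(v)(V, W)`. -/
def variation2 (J : W12 Ω n → ℝ) (v : W12 Ω n) (V W : W012 Ω n) : ℝ :=
  iteratedFDeriv ℝ 2 (fun X : W012 Ω n => J (v + X)) 0 ![V, W]

/-- The third variation `δ³J(v)(U, V, W)`. -/
def variation3 (J : W12 Ω n → ℝ) (v : W12 Ω n) (U V W : W012 Ω n) : ℝ :=
  iteratedFDeriv ℝ 3 (fun X : W012 Ω n => J (v + X)) 0 ![U, V, W]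

/-- `J` is `W^{1,2}`-elliptic on `H`, with coercivity constant `lam` and bound `Lam`. -/
structure IsElliptic (J : W12 Ω n → ℝ) (H : Set (W12 Ω n)) (lam Lam : ℝ) : Prop where
  c2 : IsCk 2 J H
  coercive : ∀ v ∈ H, ∀ V : W012 Ω n, lam * ‖V‖ ^ 2 ≤ variation2 J v V V
  bounded : ∀ v ∈ H, ∀ V W : W012 Ω n, |variation2 J v V W| ≤ Lam * ‖V‖ * ‖W‖

/-- The bound `|δ³J(v)(U,V,V)| ≤ K(R) ‖U‖_{W^{2,2}} ‖V‖_{W^{1,2}} N(V)` for all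
`v ∈ H ∩ W^{1,q}` with `‖v‖_{W^{1,q}} ≤ R`, all `U ∈ W^{2,2}`, and all `V` with `N(V) < ∞`. -/
def ThirdVariationBound (J : W12 Ω n → ℝ) (H : Set (W12 Ω n)) (q : ℝ≥0∞) (K : ℝ≥0 → ℝ≥0)
    (N : W012 Ω n → ℝ≥0∞) : Prop :=
  ∀ R : ℝ≥0, ∀ v ∈ H, sobolevNorm Ω 1 q (toFun v) ≤ R →
    ∀ U : W012 Ω n, sobolevNorm Ω 2 2 (toFun (U : W12 Ω n)) ≠ ⊤ →
    ∀ V : W012 Ω n, N V ≠ ⊤ →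
      |variation3 J v U V V| ≤
        K R * (sobolevNorm Ω 2 2 (toFun (U : W12 Ω n))).toReal * ‖V‖ * (N V).toReal

/-- `J` is predominantly quadratic on `H` with respect to `q`: it is `C³`, and its third variation
is bounded as above with `N` either the `W^{1,2}` norm or an `L^r` norm, `1 ≤ r ≤ d`. -/
def IsPredominantlyQuadratic (J : W12 Ω n → ℝ) (H : Set (W12 Ω n)) (q : ℝ≥0∞)
    (K : ℝ≥0 → ℝ≥0) : Prop :=
  IsCk 3 J H ∧
    (ThirdVariationBound J H q K (fun V => ‖V‖ₑ) ∨
      ∃ r : ℝ, 1 ≤ r ∧ r ≤ d ∧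
        ThirdVariationBound J H q K
          (fun V => eLpNorm (toFun (V : W12 Ω n)) (ENNReal.ofReal r) (volume.restrict Ω)))

end Energies

/-! ### Grids and discrete spaces -/

section Discrete

variable {d n : ℕ} {Ω : Set (E d)}

/-- `F` is a `C^∞` diffeomorphism from the element `T` onto the reference element `Tref`, with
inverse `F'`, that scales with `h` of order `m` (with constants `c`, `C`). -/
structure IsScalingDiffeo (h : ℝ) (m : ℕ) (c C : ℝ) (T Tref : Set (E d)) (F F' : E d → E d) :
    Prop where
  smooth : ContDiffOn ℝ ∞ F T
  smooth_inv : ContDiffOn ℝ ∞ F' Tref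
  bijOn : BijOn F T Tref
  invOn : InvOn F' F T Tref
  le_det : ENNReal.ofReal (c * (h ^ d)⁻¹) ≤ ⨆ x ∈ T, ‖(fderiv ℝ F x).det‖ₑ
  det_le : ⨆ x ∈ T, ‖(fderiv ℝ F x).det‖ₑ ≤ ENNReal.ofReal (C * (h ^ d)⁻¹)
  partial_le : ∀ i : Fin d, ⨆ x ∈ T, ‖fderiv ℝ F x (EuclideanSpace.single i (1 : ℝ))‖ₑ ≤
    ENNReal.ofReal (C * h⁻¹)
  inv_le : ∀ k ≤ m, ⨆ y ∈ Tref, ‖iteratedFDeriv ℝ k F' y‖ₑ ≤ ENNReal.ofReal (C * h ^ k)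

/-- `G` is a grid for `Ω` of width `h` and order `m`: a finite partition of `Ω`, up to a null set,
into open elements, each with a scaling diffeomorphism onto the reference element `Tref`.
(No use is made of the shape of the elements, nor of the way their closures intersect, so nothing
is required here.) -/
structure IsGrid (Ω : Set (E d)) (h : ℝ) (m : ℕ) (c C : ℝ) (Tref : Set (E d))
    (G : Set (Set (E d))) : Prop where
  finite : G.Finite
  isOpen : ∀ T ∈ G, IsOpen T
  subset : ∀ T ∈ G, T ⊆ Ω
  disjoint : G.PairwiseDisjoint id
  cover : volume (Ω \ ⋃₀ G) = 0
  diffeo : ∀ T ∈ G, ∃ F F' : E d → E d, IsScalingDiffeo h m c C T Tref F F'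

/-- `A` is a finite-dimensional affine space of continuous functions in `W_φ^{1,2}`.
The discrete problem is posed on `S_{h;φ} = H ∩ A` (which is `A` if `H = W_φ^{1,2}`),
and `S_{h;0}` is the direction of `A`. -/
structure IsDiscreteSpace (φ : W12 Ω n) (A : AffineSubspace ℝ (W12 Ω n)) : Prop where
  finiteDimensional : FiniteDimensional ℝ A.direction
  subset : (A : Set (W12 Ω n)) ⊆ WBdry φ
  continuous : ∀ v ∈ A, ∃ f : E d → E n, ContinuousOn f Ω ∧ toFun v =ᵐ[volume.restrict Ω] f

/-- `S` has approximations `u_I ∈ S` of all functions `u ∈ W^{k,p}` with the boundary values of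
`φ`, with the optimal order for functions and first derivatives (constant `Ca`), and with stability
in the seminorm `|·|_{W^{l,s}}` (constant `Cs l s`) for `l = 1` and for `k - d/p ≤ l ≤ k`, with `s`
at most the Sobolev exponent of `W^{k,p}` for derivatives of order `l`. -/
def HasApproximation (G : Set (Set (E d))) (h : ℝ) (φ : W12 Ω n) (S : Set (W12 Ω n))
    (k : ℕ) (p : ℝ) (Ca : ℝ≥0) (Cs : ℕ → ℝ≥0∞ → ℝ≥0) : Prop :=
  ∀ u ∈ WBdry φ, sobolevNorm Ω k (ENNReal.ofReal p) (toFun u) ≠ ⊤ →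
    ∃ uI ∈ S,
      (∀ (l : ℕ) (s : ℝ≥0∞), 1 ≤ l → l ≤ k → (l = 1 ∨ (k : ℝ) - d / p ≤ l) → 1 ≤ s →
        (p * ((k : ℝ) - l) < d → s ≤ ENNReal.ofReal (p * d / (d - p * ((k : ℝ) - l)))) →
        gridSeminorm Ω G l s (toFun uI) ≤ Cs l s * sobolevSeminorm Ω l s (toFun u)) ∧
      eLpNorm (toFun (u - uI)) (ENNReal.ofReal p) (volume.restrict Ω) +
          ENNReal.ofReal h * sobolevSeminorm Ω 1 (ENNReal.ofReal p) (toFun (u - uI)) ≤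
        Ca * ENNReal.ofReal (h ^ k) * sobolevSeminorm Ω k (ENNReal.ofReal p) (toFun u)

/-- Approximation condition of order `m`: the above for all `1 ≤ k ≤ m + 1` and `1 ≤ p < ∞` with
`k p > d`, and for `W^{2,2}`. -/
def ApproximationCondition (G : Set (Set (E d))) (h : ℝ) (m : ℕ) (φ : W12 Ω n)
    (S : Set (W12 Ω n)) (Ca : ℕ → ℝ → ℝ≥0) (Cs : ℕ → ℝ → ℕ → ℝ≥0∞ → ℝ≥0) : Prop :=
  ∀ (k : ℕ) (p : ℝ), 1 ≤ k → k ≤ m + 1 → 1 ≤ p → ((d : ℝ) < k * p ∨ (k = 2 ∧ p = 2)) →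
    HasApproximation G h φ S k p (Ca k p) (Cs k p)

/-- The inverse estimate
`‖v_h‖_{W^{1,s}} ≤ Ci h^{-d max(0, 1/t - 1/s)} ‖v_h‖_{W^{1,t}}` for `v_h ∈ S₀`, `s, t ∈ [1,∞]`
(with `1/∞ = 0`). -/
def InverseEstimate (h : ℝ) (S₀ : Submodule ℝ (W12 Ω n)) (Ci : ℝ≥0∞ → ℝ≥0∞ → ℝ≥0) : Prop :=
  ∀ v ∈ S₀, ∀ s t : ℝ≥0∞, 1 ≤ s → 1 ≤ t →
    sobolevNorm Ω 1 s (toFun v) ≤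
      Ci s t * ENNReal.ofReal (h ^ (-((d : ℝ) * max 0 (t.toReal⁻¹ - s.toReal⁻¹)))) *
        sobolevNorm Ω 1 t (toFun v)

/-- `H²`-regularity of the adjoint problem, with constant `Cr`: the solution `W ∈ W₀^{1,2}` of
`δ²J(u)(W, V) = -(V, u_h - u)_{L²}` for all `V ∈ W₀^{1,2}`
satisfies `‖W‖_{W^{2,2}} ≤ Cr ‖u - u_h‖_{L²}`. -/
def AdjointH2Regular (J : W12 Ω n → ℝ) (u uh : W12 Ω n) (Cr : ℝ≥0) : Prop :=
  ∀ W : W012 Ω n,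
    (∀ V : W012 Ω n, variation2 J u W V = -inner ℝ (toL2 (V : W12 Ω n)) (toL2 (uh - u))) →
    sobolevNorm Ω 2 2 (toFun (W : W12 Ω n)) ≤ Cr * ‖toL2 (u - uh)‖ₑ

end Discrete

end SemilinearFEM

end

/-!
The proof is the duality argument of Aubin and Nitsche for a nonlinear energy.

Let `e = u_h - u` and let `W ∈ W₀^{1,2}` be the solution of the adjoint problem; it exists by the
Lax–Milgram theorem (`exists_adjoint_solution`), so that `‖e‖²_{L²} = -δ²J(u)(W, e)`. Now
`δ²J(u)(W, e)` is the derivative at `s = 0` of `s ↦ δJ(u + s e)(W)`, which vanishes at `s = 0`. At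
`s = 1` it equals `δJ(u_h)(W - W_I)`, where `W_I` is the discrete approximation of `W`, and hence it
is at most `Λ ‖e‖_{W^{1,2}} ‖W - W_I‖_{W^{1,2}}`, which is of the order `h^{m+1} ‖e‖_{L²}`. The
remainder of the Taylor expansion is bounded by the third variation along the segment from `u` to
`u_h` (`neg_variation_le`), hence by `K(R) ‖W‖_{W^{2,2}} ‖e‖_{W^{1,2}} N(e)`, where `N` is the
`W^{1,2}` norm or an `L^r` norm with `r ≤ d`.

To make `R` uniform in `h`, the discrete solution is compared with the approximation `u_I` of `u`:
`u_I` is stable in `W^{1,q}`, and `u_h - u_I`, which is of the order `h^m` in `W^{1,2}`, is bounded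
in `W^{1,q}` by the inverse estimate (`inverse_exponent_le`, `exists_uniform_bounds`).

It remains to bound `N(e)`. The `W^{1,2}` norm is of the order `h^m`, and so is the `L^r` norm for
`d ≤ 2`. For `d ≥ 3` the `L^r` norm is interpolated between `L²` and `L^∞`, and
`N(e) ≤ c ‖e‖_{L²}^{2/d}`; as `d < 2 (m + 1)`, the product `h^m ‖e‖_{L²}^{2/d}` is absorbed
(`le_of_le_add_rpow`). The bound of `e` in `L^∞` comes from its bound in `W^{1,q}`, `q > d`, and its
zero boundary values (`exists_eLpNorm_top_le_gradNorm`). No embedding theorem for `Ω` is needed: `e`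
is extended by zero, and a ball `B` is chosen such that `x + B` is outside `Ω` for all `x ∈ Ω`; then
`e(x)` is bounded by the average of `|∇e|` over the segments from `x` to the points of `x + B`, and
Hölder's inequality applies (`segmentIntegral_le`).
-/

noncomputable section

namespace SemilinearFEM

/-! ### Weak derivatives and first-order Sobolev norms -/

section WeakDeriv

variable {d n k : ℕ} {Ω : Set (E d)}

theorem IsTestFunction.mono {T : Set (E d)} (hT : T ⊆ Ω) {η : E d → ℝ}
    (hη : IsTestFunction T η) : IsTestFunction Ω η :=
  ⟨hη.1, hη.2.1, hη.2.2.trans hT⟩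

theorem IsTestFunction.eq_zero {η : E d → ℝ} (hη : IsTestFunction Ω η) {x : E d}
    (hx : x ∉ Ω) : η x = 0 :=
  image_eq_zero_of_notMem_tsupport fun h => hx (hη.2.2 h)

theorem IsTestFunction.partialDeriv_eq_zero {η : E d → ℝ} (hη : IsTestFunction Ω η)
    (α : Fin k → Fin d) {x : E d} (hx : x ∉ Ω) : partialDeriv α η x = 0 := by
  have : iteratedFDeriv ℝ k η x = 0 := by
    by_contra h0
    exact hx (hη.2.2 (support_iteratedFDeriv_subset (𝕜 := ℝ) (f := η) k h0))
  simp [partialDeriv, this]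

theorem partialDeriv_one (i : Fin d) (η : E d → ℝ) (x : E d) :
    partialDeriv (fun _ : Fin 1 => i) η x = fderiv ℝ η x (EuclideanSpace.single i (1 : ℝ)) := by
  simp [partialDeriv, iteratedFDeriv_one_apply]

theorem HasWeakDeriv.mono {T : Set (E d)} (hΩ : IsOpen Ω) (hT : T ⊆ Ω) {α : Fin k → Fin d}
    {f g : E d → E n} (h : HasWeakDeriv Ω α f g) : HasWeakDeriv T α f g where
  locInt := h.locInt.mono_set hT
  locInt_deriv := h.locInt_deriv.mono_set hT
  integral_eq := by
    intro η hη
    have e1 : ∫ x in Ω, partialDeriv α η x • f x = ∫ x in T, partialDeriv α η x • f x :=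
      setIntegral_eq_of_subset_of_forall_sdiff_eq_zero hΩ.measurableSet hT
        fun x hx => by rw [hη.partialDeriv_eq_zero α hx.2, zero_smul]
    have e2 : ∫ x in Ω, η x • g x = ∫ x in T, η x • g x :=
      setIntegral_eq_of_subset_of_forall_sdiff_eq_zero hΩ.measurableSet hT
        fun x hx => by rw [hη.eq_zero hx.2, zero_smul]
    rw [← e1, ← e2]
    exact h.integral_eq η (hη.mono hT)

/-- Weak derivatives on an open set are unique almost everywhere. -/
theorem HasWeakDeriv.ae_eq (hΩ : IsOpen Ω) {α : Fin k → Fin d} {f g g' : E d → E n}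
    (h : HasWeakDeriv Ω α f g) (h' : HasWeakDeriv Ω α f g') :
    g =ᵐ[volume.restrict Ω] g' := by
  have key : ∀ᵐ x, x ∈ Ω → (g - g') x = 0 := by
    refine hΩ.ae_eq_zero_of_integral_contDiff_smul_eq_zero
      (h.locInt_deriv.sub h'.locInt_deriv) fun η h1 h2 h3 => ?_
    have hη : IsTestFunction Ω η := ⟨h1, h2, h3⟩
    rw [← setIntegral_eq_integral_of_forall_compl_eq_zero
      (s := Ω) fun x hx => by rw [hη.eq_zero hx, zero_smul]]
    simp only [Pi.sub_apply, smul_sub]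
    rw [integral_sub
      (integrable_smul_of_locallyIntegrableOn h1.continuous h2 h3 h.locInt_deriv)
      (integrable_smul_of_locallyIntegrableOn h1.continuous h2 h3 h'.locInt_deriv), sub_eq_zero]
    have := (h.integral_eq η hη).symm.trans (h'.integral_eq η hη)
    exact smul_right_injective (E n) (pow_ne_zero k (by norm_num : (-1 : ℝ) ≠ 0)) this
  rw [Filter.EventuallyEq, ae_restrict_iff' hΩ.measurableSet]
  filter_upwards [key] with x hx hxΩ
  exact sub_eq_zero.1 (hx hxΩ)

/-- The classical partial derivatives of a smooth function are its weak ones. -/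
theorem hasWeakDeriv_of_contDiff (η : E d → E n) (hη : ContDiff ℝ ∞ η) (i : Fin d) :
    HasWeakDeriv Ω (fun _ : Fin 1 => i) η
      (fun x => fderiv ℝ η x (EuclideanSpace.single i (1 : ℝ))) := by
  have hc : Continuous fun x => fderiv ℝ η x (EuclideanSpace.single i (1 : ℝ)) :=
    (hη.continuous_fderiv (by simp)).clm_apply continuous_const
  refine ⟨hη.continuous.locallyIntegrable.locallyIntegrableOn Ω,
    hc.locallyIntegrable.locallyIntegrableOn Ω, fun ζ hζ => ?_⟩
  have hcζ : Continuous fun x => fderiv ℝ ζ x (EuclideanSpace.single i (1 : ℝ)) :=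
    (hζ.1.continuous_fderiv (by simp)).clm_apply continuous_const
  simp only [partialDeriv_one, pow_one]
  rw [setIntegral_eq_integral_of_forall_compl_eq_zero fun x hx => by
      rw [← partialDeriv_one, hζ.partialDeriv_eq_zero _ hx, zero_smul],
    setIntegral_eq_integral_of_forall_compl_eq_zero fun x hx => by
      rw [hζ.eq_zero hx, zero_smul]]
  have hs : HasCompactSupport fun x => fderiv ℝ ζ x (EuclideanSpace.single i (1 : ℝ)) :=
    hζ.2.1.fderiv_apply (𝕜 := ℝ) _
  rw [neg_one_smul, integral_smul_fderiv_eq_neg_fderiv_smul_of_integrable, neg_neg]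
  · exact (hcζ.smul hη.continuous).integrable_of_hasCompactSupport hs.smul_right
  · exact (hζ.1.continuous.smul hc).integrable_of_hasCompactSupport hζ.2.1.smul_right
  · exact (hζ.1.continuous.smul hη.continuous).integrable_of_hasCompactSupport
      hζ.2.1.smul_right
  · exact fun x _ => (hζ.1.differentiable (by simp)) x
  · exact fun x _ => (hη.differentiable (by simp)) x

end WeakDeriv

section FirstOrderNorms

variable {d n : ℕ} {Ω : Set (E d)}

theorem norm_toLp_le_sum {ι : Type*} [Fintype ι] (a : ι → E n) :
    ‖(WithLp.toLp 2 a : PiLp 2 (fun _ : ι => E n))‖ ≤ ∑ i, ‖a i‖ := by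
  rw [PiLp.norm_eq_of_L2]
  refine Real.sqrt_le_iff.2 ⟨Finset.sum_nonneg fun i _ => norm_nonneg _, ?_⟩
  exact Finset.sum_sq_le_sq_sum_of_nonneg fun i _ => norm_nonneg _

theorem hasWeakDeriv_toFun (u : W12 Ω n) (i : Fin d) :
    HasWeakDeriv Ω (fun _ : Fin 1 => i) (toFun u) (u.1 (some i)) := u.2 i

theorem locallyIntegrableOn_toFun {d n : ℕ} {Ω : Set (E d)} (hd : 1 ≤ d) (u : W12 Ω n) :
    LocallyIntegrableOn (toFun u) Ω := (u.2 ⟨0, hd⟩).locInt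

/-- The sum of the `L^p` norms of the first-order partial derivatives of `u`.  It is equivalent to
`|u|_{W^{1,p}}`, uniformly in `p`. -/
def gradNorm (p : ℝ≥0∞) (u : W12 Ω n) : ℝ≥0∞ :=
  ∑ i : Fin d, eLpNorm (u.1 (some i)) p (volume.restrict Ω)

/-- For a function in `W^{1,2}(Ω)`, the elementwise first-order seminorm on a partition of `Ω`
controls the global one. -/
theorem gradNorm_le_gridSeminorm (hΩ : IsOpen Ω) {G : Set (Set (E d))} (hf : G.Finite)
    (ho : ∀ T ∈ G, IsOpen T) (hs : ∀ T ∈ G, T ⊆ Ω) (hcov : volume (Ω \ ⋃₀ G) = 0)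
    (p : ℝ≥0∞) (u : W12 Ω n) :
    gradNorm p u ≤ d * gridSeminorm Ω G 1 p (toFun u) := by
  have key : ∀ i : Fin d, eLpNorm (u.1 (some i)) p (volume.restrict Ω) ≤
      gridSeminorm Ω G 1 p (toFun u) := by
    refine fun i => le_iInf₂ fun g hg => ?_
    have hae : u.1 (some i) =ᵐ[volume.restrict Ω] g (fun _ => i) := by
      have h1 : ∀ᵐ x, ∀ T ∈ G, x ∈ T → u.1 (some i) x = g (fun _ => i) x := by
        rw [ae_ball_iff hf.countable]
        intro T hT
        rw [← ae_restrict_iff' (ho T hT).measurableSet]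
        exact ((hasWeakDeriv_toFun u i).mono hΩ (hs T hT)).ae_eq (ho T hT) (hg _ T hT)
      have h2 : ∀ᵐ x, x ∉ Ω \ ⋃₀ G := measure_eq_zero_iff_ae_notMem.1 hcov
      rw [Filter.EventuallyEq, ae_restrict_iff' hΩ.measurableSet]
      filter_upwards [h1, h2] with x hx1 hx2 hxΩ
      obtain ⟨T, hT, hxT⟩ : x ∈ ⋃₀ G := by
        by_contra hn
        exact hx2 ⟨hxΩ, hn⟩
      exact hx1 T hT hxT
    rw [eLpNorm_congr_ae hae]
    refine eLpNorm_mono fun x => ?_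
    exact PiLp.norm_apply_le (WithLp.toLp 2 fun α => g α x : PiLp 2 (fun _ => E n)) fun _ => i
  calc gradNorm p u ≤ ∑ _i : Fin d, gridSeminorm Ω G 1 p (toFun u) :=
        Finset.sum_le_sum fun i _ => key i
    _ = d * gridSeminorm Ω G 1 p (toFun u) := by simp

theorem gradNorm_le_sobolevSeminorm (hΩ : IsOpen Ω) (p : ℝ≥0∞) (u : W12 Ω n) :
    gradNorm p u ≤ d * sobolevSeminorm Ω 1 p (toFun u) :=
  gradNorm_le_gridSeminorm hΩ (finite_singleton Ω) (by simpa using hΩ) (by simp) (by simp) p u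

theorem sobolevSeminorm_one_le {p : ℝ≥0∞} (hp : 1 ≤ p) (u : W12 Ω n) :
    sobolevSeminorm Ω 1 p (toFun u) ≤ gradNorm p u := by
  let g : (Fin 1 → Fin d) → E d → E n := fun α => u.1 (some (α 0))
  have hg : ∀ α, ∀ T ∈ ({Ω} : Set (Set (E d))), HasWeakDeriv T α (toFun u) (g α) := by
    rintro α T rfl
    have : α = fun _ => α 0 := by
      ext j
      rw [Subsingleton.elim j 0]
    rw [this]
    exact hasWeakDeriv_toFun u (α 0)
  refine (iInf₂_le g hg).trans ?_
  calc _ ≤ eLpNorm (∑ α : Fin 1 → Fin d, fun x => ‖g α x‖) p (volume.restrict Ω) := by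
        refine eLpNorm_mono_real fun x => ?_
        simpa using norm_toLp_le_sum fun α => g α x
    _ ≤ ∑ α : Fin 1 → Fin d, eLpNorm (fun x => ‖g α x‖) p (volume.restrict Ω) :=
        eLpNorm_sum_le (fun α _ => (Lp.aestronglyMeasurable _).norm) hp
    _ = ∑ α : Fin 1 → Fin d, eLpNorm (u.1 (some (α 0))) p (volume.restrict Ω) := by
        simp only [eLpNorm_norm, g]
    _ = gradNorm p u :=
        (Equiv.funUnique (Fin 1) (Fin d)).sum_comp
          fun i => eLpNorm (u.1 (some i)) p (volume.restrict Ω)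

theorem partialDeriv_zero (α : Fin 0 → Fin d) (η : E d → ℝ) (x : E d) :
    partialDeriv α η x = η x := by
  simp [partialDeriv]

theorem hasWeakDeriv_zero_order (α : Fin 0 → Fin d) {f : E d → E n}
    (hf : LocallyIntegrableOn f Ω) : HasWeakDeriv Ω α f f :=
  ⟨hf, hf, fun η _ => by simp [partialDeriv_zero]⟩

theorem sobolevSeminorm_zero_le {p : ℝ≥0∞} {f : E d → E n}
    (hf : LocallyIntegrableOn f Ω) :
    sobolevSeminorm Ω 0 p f ≤ eLpNorm f p (volume.restrict Ω) := by
  refine (iInf₂_le (fun _ => f) fun α T hT => ?_).trans ?_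
  · rw [mem_singleton_iff.1 hT]
    exact hasWeakDeriv_zero_order α hf
  · refine eLpNorm_mono fun x => ?_
    simpa using norm_toLp_le_sum fun _ : Fin 0 → Fin d => f x

theorem eLpNorm_le_sobolevSeminorm_zero (hΩ : IsOpen Ω) {p : ℝ≥0∞} {f : E d → E n} :
    eLpNorm f p (volume.restrict Ω) ≤ sobolevSeminorm Ω 0 p f := by
  refine le_iInf₂ fun g hg => ?_
  have h := hg Fin.elim0 Ω rfl
  rw [eLpNorm_congr_ae ((hasWeakDeriv_zero_order Fin.elim0 h.locInt).ae_eq hΩ h)]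
  refine eLpNorm_mono fun x => ?_
  exact PiLp.norm_apply_le (WithLp.toLp 2 fun α => g α x : PiLp 2 (fun _ => E n)) Fin.elim0

theorem sobolevNorm_one_le (hd : 1 ≤ d) {p : ℝ≥0∞} (hp : 1 ≤ p) (u : W12 Ω n) :
    sobolevNorm Ω 1 p (toFun u) ≤ eLpNorm (toFun u) p (volume.restrict Ω) + gradNorm p u := by
  simp only [sobolevNorm, Finset.sum_range_succ, Finset.sum_range_zero, zero_add]
  exact add_le_add (sobolevSeminorm_zero_le (locallyIntegrableOn_toFun hd u))
    (sobolevSeminorm_one_le hp u)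

theorem eLpNorm_le_sobolevNorm_one (hΩ : IsOpen Ω) (p : ℝ≥0∞) (f : E d → E n) :
    eLpNorm f p (volume.restrict Ω) ≤ sobolevNorm Ω 1 p f := by
  simp only [sobolevNorm, Finset.sum_range_succ, Finset.sum_range_zero, zero_add]
  exact (eLpNorm_le_sobolevSeminorm_zero hΩ).trans le_self_add

theorem sobolevSeminorm_le_sobolevNorm (k : ℕ) (p : ℝ≥0∞) (f : E d → E n) :
    sobolevSeminorm Ω k p f ≤ sobolevNorm Ω k p f :=
  Finset.single_le_sum (f := fun l => sobolevSeminorm Ω l p f) (fun _ _ => zero_le)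
    (Finset.self_mem_range_succ k)

theorem gradNorm_sub_le {p : ℝ≥0∞} (hp : 1 ≤ p) (u v : W12 Ω n) :
    gradNorm p (u - v) ≤ gradNorm p u + gradNorm p v := by
  rw [gradNorm, gradNorm, gradNorm, ← Finset.sum_add_distrib]
  refine Finset.sum_le_sum fun i _ => ?_
  rw [show (u - v).1 (some i) = u.1 (some i) - v.1 (some i) from rfl,
    eLpNorm_congr_ae (Lp.coeFn_sub _ _)]
  exact eLpNorm_sub_le (Lp.aestronglyMeasurable _) (Lp.aestronglyMeasurable _) hp

theorem gradNorm_add_le {p : ℝ≥0∞} (hp : 1 ≤ p) (u v : W12 Ω n) :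
    gradNorm p (u + v) ≤ gradNorm p u + gradNorm p v := by
  rw [gradNorm, gradNorm, gradNorm, ← Finset.sum_add_distrib]
  refine Finset.sum_le_sum fun i _ => ?_
  rw [show (u + v).1 (some i) = u.1 (some i) + v.1 (some i) from rfl,
    eLpNorm_congr_ae (Lp.coeFn_add _ _)]
  exact eLpNorm_add_le (Lp.aestronglyMeasurable _) (Lp.aestronglyMeasurable _) hp

theorem gradNorm_smul (p : ℝ≥0∞) (c : ℝ) (u : W12 Ω n) :
    gradNorm p (c • u) = ‖c‖ₑ * gradNorm p u := by
  rw [gradNorm, gradNorm, Finset.mul_sum]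
  refine Finset.sum_congr rfl fun i _ => ?_
  rw [show (c • u).1 (some i) = c • u.1 (some i) from rfl,
    eLpNorm_congr_ae (Lp.coeFn_smul _ _), eLpNorm_const_smul]

theorem enorm_toL2 (u : W12 Ω n) :
    ‖toL2 u‖ₑ = eLpNorm (toFun u) 2 (volume.restrict Ω) := Lp.enorm_def _

theorem norm_toL2_le (u : W12 Ω n) : ‖toL2 u‖ ≤ ‖u‖ := PiLp.norm_apply_le u.1 none

theorem gradNorm_two_le (u : W12 Ω n) : gradNorm 2 u ≤ d * ‖u‖ₑ := by
  calc gradNorm 2 u ≤ ∑ _i : Fin d, ‖u‖ₑ := Finset.sum_le_sum fun i _ => by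
        rw [← Lp.enorm_def, enorm_le_iff_norm_le]
        exact PiLp.norm_apply_le u.1 (some i)
    _ = d * ‖u‖ₑ := by simp

theorem enorm_le_eLpNorm_add_gradNorm (u : W12 Ω n) :
    ‖u‖ₑ ≤ eLpNorm (toFun u) 2 (volume.restrict Ω) + gradNorm 2 u := by
  have h : ‖u‖ ≤ ‖toL2 u‖ + ∑ i, ‖u.1 (some i)‖ := by
    rw [show ‖u‖ = ‖u.1‖ from rfl, PiLp.norm_eq_of_L2]
    refine Real.sqrt_le_iff.2 ⟨by positivity, ?_⟩
    have := Finset.sum_sq_le_sq_sum_of_nonneg (s := Finset.univ) (f := fun i => ‖u.1 i‖)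
      fun i _ => norm_nonneg _
    rwa [Fintype.sum_option (f := fun i => ‖u.1 i‖)] at this
  rw [← enorm_toL2, gradNorm]
  simp only [← Lp.enorm_def, ← ofReal_norm]
  rw [← ENNReal.ofReal_sum_of_nonneg fun i _ => norm_nonneg _,
    ← ENNReal.ofReal_add (norm_nonneg _) (Finset.sum_nonneg fun i _ => norm_nonneg _)]
  exact ENNReal.ofReal_le_ofReal h

end FirstOrderNorms

/-! ### Completeness of `W^{1,2}` -/

section Completeness

variable {d n : ℕ} {Ω : Set (E d)}

theorem isFiniteMeasure_restrict_of_isBounded (hΩb : Bornology.IsBounded Ω) :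
    IsFiniteMeasure (volume.restrict Ω) :=
  ⟨by simpa using hΩb.measure_lt_top⟩

theorem eLpNorm_one_le_eLpNorm_two (f : Lp (E n) 2 (volume.restrict Ω)) :
    eLpNorm f 1 (volume.restrict Ω) ≤
      volume Ω ^ (1 / 2 : ℝ) * eLpNorm f 2 (volume.restrict Ω) := by
  have := eLpNorm_le_eLpNorm_mul_rpow_measure_univ (μ := volume.restrict Ω) (p := 1) (q := 2)
    (f := f) (by norm_num) (Lp.aestronglyMeasurable f)
  rw [mul_comm]
  convert this using 2
  norm_num

theorem locallyIntegrableOn_Lp (hΩb : Bornology.IsBounded Ω)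
    (f : Lp (E n) 2 (volume.restrict Ω)) : LocallyIntegrableOn f Ω := by
  have := isFiniteMeasure_restrict_of_isBounded hΩb
  have h : IntegrableOn f Ω := (Lp.memLp f).integrable (by norm_num)
  exact h.locallyIntegrableOn

/-- Integration against a bounded function is continuous on `L²(Ω)` if `Ω` is bounded. -/
theorem continuous_setIntegral_smul (hΩb : Bornology.IsBounded Ω) {ζ : E d → ℝ} {C : ℝ}
    (hζ : ∀ x, ‖ζ x‖ ≤ C)
    (hint : ∀ f : Lp (E n) 2 (volume.restrict Ω),
      Integrable (fun x => ζ x • f x) (volume.restrict Ω)) :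
    Continuous fun f : Lp (E n) 2 (volume.restrict Ω) => ∫ x in Ω, ζ x • f x := by
  let L : Lp (E n) 2 (volume.restrict Ω) →+ E n :=
    AddMonoidHom.mk' (fun f => ∫ x in Ω, ζ x • f x) fun f g => by
      rw [← integral_add (hint f) (hint g)]
      refine integral_congr_ae ?_
      filter_upwards [Lp.coeFn_add f g] with x hx
      rw [hx, Pi.add_apply, smul_add]
  refine AddMonoidHomClass.continuous_of_bound L
    (C * (volume Ω ^ (1 / 2 : ℝ)).toReal) fun f => ?_
  have hv : volume Ω ^ (1 / 2 : ℝ) ≠ ⊤ :=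
    ENNReal.rpow_ne_top_of_nonneg (by norm_num) hΩb.measure_lt_top.ne
  have hC : 0 ≤ C := (norm_nonneg _).trans (hζ 0)
  have h : ‖L f‖ₑ ≤ ENNReal.ofReal C * (volume Ω ^ (1 / 2 : ℝ) * ‖f‖ₑ) := by
    calc ‖L f‖ₑ ≤ ∫⁻ x in Ω, ‖ζ x • f x‖ₑ := enorm_integral_le_lintegral_enorm _
      _ ≤ ∫⁻ x in Ω, ENNReal.ofReal C * ‖f x‖ₑ := by
          refine lintegral_mono fun x => ?_
          rw [enorm_smul]
          gcongr
          rw [← ofReal_norm]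
          exact ENNReal.ofReal_le_ofReal (hζ x)
      _ = ENNReal.ofReal C * eLpNorm f 1 (volume.restrict Ω) := by
          rw [lintegral_const_mul' _ _ ENNReal.ofReal_ne_top, eLpNorm_one_eq_lintegral_enorm]
      _ ≤ _ := by
          rw [Lp.enorm_def]
          gcongr
          exact eLpNorm_one_le_eLpNorm_two f
  have h2 := ENNReal.toReal_mono (ENNReal.mul_ne_top ENNReal.ofReal_ne_top
    (ENNReal.mul_ne_top hv enorm_ne_top)) h
  simpa [ENNReal.toReal_mul, ENNReal.toReal_ofReal hC, mul_assoc] using h2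

/-- `W^{1,2}` is closed, since the identities defining weak derivatives pass to limits in `L²`. -/
theorem isClosed_W12 (hΩb : Bornology.IsBounded Ω) :
    IsClosed (W12 Ω n : Set (PiLp 2 fun _ : Option (Fin d) =>
      Lp (E n) 2 (volume.restrict Ω))) := by
  have hset : (W12 Ω n : Set (PiLp 2 fun _ : Option (Fin d) =>
      Lp (E n) 2 (volume.restrict Ω))) =
      ⋂ (i : Fin d) (η : E d → ℝ) (_ : IsTestFunction Ω η),
        {F | ∫ x in Ω, partialDeriv (fun _ : Fin 1 => i) η x • F none x =
          (-1 : ℝ) ^ 1 • ∫ x in Ω, η x • F (some i) x} := by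
    ext F
    simp only [mem_iInter, mem_ofPred_eq]
    exact ⟨fun h i η hη => (h i).integral_eq η hη, fun h i =>
      ⟨locallyIntegrableOn_Lp hΩb _, locallyIntegrableOn_Lp hΩb _, h i⟩⟩
  rw [hset]
  refine isClosed_iInter fun i => isClosed_iInter fun η => isClosed_iInter fun hη => ?_
  simp only [pow_one, neg_one_smul]
  refine isClosed_eq ?_ (Continuous.neg ?_)
  · have hc : Continuous fun x => fderiv ℝ η x (EuclideanSpace.single i (1 : ℝ)) :=
      (hη.1.continuous_fderiv (by simp)).clm_apply continuous_const
    have hs : HasCompactSupport fun x => fderiv ℝ η x (EuclideanSpace.single i (1 : ℝ)) :=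
      hη.2.1.fderiv_apply (𝕜 := ℝ) _
    obtain ⟨C, hC⟩ := hs.exists_bound_of_continuous hc
    refine (continuous_setIntegral_smul hΩb (C := C)
      (ζ := fun x => partialDeriv (fun _ : Fin 1 => i) η x) (fun x => ?_)
      fun f => integrable_partialDeriv_smul _ hη (locallyIntegrableOn_Lp hΩb f)).comp
      (PiLp.continuous_apply 2 _ none)
    rw [partialDeriv_one]
    exact hC x
  · obtain ⟨C, hC⟩ := hη.2.1.exists_bound_of_continuous hη.1.continuous
    exact (continuous_setIntegral_smul hΩb hC
      fun f => integrable_smul_of_locallyIntegrableOn hη.1.continuous hη.2.1 hη.2.2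
        (locallyIntegrableOn_Lp hΩb f)).comp (PiLp.continuous_apply 2 _ (some i))

theorem completeSpace_W012 (hΩb : Bornology.IsBounded Ω) : CompleteSpace (W012 Ω n) := by
  have : CompleteSpace (W12 Ω n) := (isClosed_W12 hΩb).completeSpace_coe
  exact (Submodule.isClosed_topologicalClosure _).completeSpace_coe

end Completeness

/-! ### Averages over segments and the embedding of `W₀^{1,2} ∩ W^{1,q}` into `L^∞` -/

section SegmentAverage

variable {d : ℕ}

/-- The integral of `f` over all segments from `x` to a point of `x + B`, with respect to the
parameter `t` of the segment and its direction `y ∈ B`. -/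
def segmentIntegral (B : Set (E d)) (f : E d → ℝ≥0∞) (x : E d) : ℝ≥0∞ :=
  ∫⁻ t in Ioc (0 : ℝ) 1, ∫⁻ y in B, f (x + t • y)

theorem measurable_comp_add_smul {f : E d → ℝ≥0∞} (hf : Measurable f) :
    Measurable fun p : (E d × ℝ) × E d => f (p.1.1 + p.1.2 • p.2) :=
  hf.comp (by fun_prop)

theorem measurable_segmentIntegral (B : Set (E d)) {f : E d → ℝ≥0∞} (hf : Measurable f) :
    Measurable (segmentIntegral B f) :=
  Measurable.lintegral_prod_right'
    (f := fun p : E d × ℝ => ∫⁻ y in B, f (p.1 + p.2 • y))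
    (Measurable.lintegral_prod_right' (measurable_comp_add_smul hf))

theorem segmentIntegral_mono (B : Set (E d)) {f g : E d → ℝ≥0∞} (h : f ≤ g) (x : E d) :
    segmentIntegral B f x ≤ segmentIntegral B g x :=
  lintegral_mono fun _ => lintegral_mono fun _ => h _

theorem segmentIntegral_add (B : Set (E d)) {f g : E d → ℝ≥0∞} (hf : Measurable f) (x : E d) :
    segmentIntegral B (fun z => f z + g z) x = segmentIntegral B f x + segmentIntegral B g x := by
  have h1 : Measurable fun p : ℝ × E d => f (x + p.1 • p.2) := hf.comp (by fun_prop)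
  rw [segmentIntegral, segmentIntegral, segmentIntegral,
    ← lintegral_add_left h1.lintegral_prod_right']
  refine lintegral_congr fun t => lintegral_add_left ?_ _
  exact hf.comp (by fun_prop)

theorem lintegral_segmentIntegral (B : Set (E d)) {f : E d → ℝ≥0∞} (hf : Measurable f) :
    ∫⁻ x, segmentIntegral B f x = volume B * ∫⁻ x, f x := by
  have hm := measurable_comp_add_smul hf
  unfold segmentIntegral
  rw [lintegral_lintegral_swap (hm.lintegral_prod_right').aemeasurable]
  have h1 : ∀ t : ℝ, ∫⁻ x, ∫⁻ y in B, f (x + t • y) = volume B * ∫⁻ x, f x := by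
    intro t
    rw [lintegral_lintegral_swap (by exact (hf.comp (by fun_prop)).aemeasurable)]
    simp only [lintegral_add_right_eq_self f, lintegral_const, Measure.restrict_apply_univ]
    rw [mul_comm]
  simp only [h1, lintegral_const, Measure.restrict_apply_univ, Real.volume_Ioc]
  simp

/-- The constant of `segmentIntegral_le`: it is finite for `r > d`, since `t^{-d/r}` is then
integrable at `0`. -/
def segmentConst (B : Set (E d)) (r : ℝ) : ℝ≥0∞ :=
  volume B ^ (1 - 1 / r) * ∫⁻ t in Ioc (0 : ℝ) 1, ENNReal.ofReal (t ^ (-(d / r : ℝ)))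

theorem segmentConst_ne_top {B : Set (E d)} (hB : volume B ≠ ⊤) {r : ℝ} (hr1 : 1 ≤ r)
    (hr : d < r) : segmentConst B r ≠ ⊤ := by
  refine ENNReal.mul_ne_top (ENNReal.rpow_ne_top_of_nonneg ?_ hB) ?_
  · rw [sub_nonneg, div_le_one (by linarith)]
    exact hr1
  · have hlt : -1 < -(d / r : ℝ) := by
      rw [neg_lt_neg_iff, div_lt_one (by linarith)]
      exact hr
    have h := (intervalIntegral.intervalIntegrable_rpow' (a := 0) (b := 1) hlt)
    rw [intervalIntegrable_iff_integrableOn_Ioc_of_le zero_le_one] at h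
    have h2 := h.lintegral_lt_top
    exact h2.ne

theorem lintegral_comp_add_smul (g : E d → ℝ≥0∞) (hg : Measurable g) (x : E d) {t : ℝ}
    (ht : 0 < t) : ∫⁻ y, g (x + t • y) = ENNReal.ofReal (t ^ (-(d : ℝ))) * ∫⁻ y, g y := by
  have h := Measure.map_addHaar_smul (volume : Measure (E d)) ht.ne'
  have h1 : ∫⁻ y, g (x + t • y) = ∫⁻ z, g (x + z) ∂(Measure.map (t • ·) volume) := by
    rw [lintegral_map (by fun_prop) (by fun_prop)]
  rw [h1, h, lintegral_smul_measure, lintegral_add_left_eq_self g, smul_eq_mul]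
  congr 2
  rw [abs_of_pos (by positivity), Real.rpow_neg ht.le]
  simp

/-- Hölder's inequality on `B`, and the scaling `y ↦ t y`, whose Jacobian contributes the
factor `t^{-d/r}`. -/
theorem segmentIntegral_le (B : Set (E d)) {f : E d → ℝ≥0∞} (hf : Measurable f) {r : ℝ}
    (hr1 : 1 ≤ r) (x : E d) :
    segmentIntegral B f x ≤ segmentConst B r * (∫⁻ z, f z ^ r) ^ (1 / r) := by
  have hr0 : 0 < r := by linarith
  have key : ∀ t ∈ Ioc (0 : ℝ) 1, ∫⁻ y in B, f (x + t • y) ≤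
      ENNReal.ofReal (t ^ (-(d / r : ℝ))) *
        ((∫⁻ z, f z ^ r) ^ (1 / r) * volume B ^ (1 - 1 / r)) := by
    intro t ht
    have h1 := eLpNorm'_le_eLpNorm'_mul_rpow_measure_univ (μ := volume.restrict B)
      (f := fun y => f (x + t • y)) one_pos hr1
      (Measurable.aestronglyMeasurable (hf.comp (by fun_prop)))
    simp only [eLpNorm', enorm_eq_self, ENNReal.rpow_one, div_one,
      Measure.restrict_apply_univ] at h1
    refine h1.trans ?_
    rw [← mul_assoc]
    gcongr
    calc (∫⁻ y in B, f (x + t • y) ^ r) ^ (1 / r)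
        ≤ (∫⁻ y, f (x + t • y) ^ r) ^ (1 / r) := by
          gcongr
          exact Measure.restrict_le_self
      _ = (ENNReal.ofReal (t ^ (-(d : ℝ))) * ∫⁻ z, f z ^ r) ^ (1 / r) := by
          rw [lintegral_comp_add_smul (fun z => f z ^ r) (hf.pow_const r) x ht.1]
      _ = ENNReal.ofReal (t ^ (-(d / r : ℝ))) * (∫⁻ z, f z ^ r) ^ (1 / r) := by
          rw [ENNReal.mul_rpow_of_nonneg _ _ (by positivity),
            ENNReal.ofReal_rpow_of_nonneg (Real.rpow_nonneg ht.1.le _) (by positivity),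
            ← Real.rpow_mul ht.1.le]
          congr 3
          ring
  calc segmentIntegral B f x
      ≤ ∫⁻ t in Ioc (0 : ℝ) 1, ENNReal.ofReal (t ^ (-(d / r : ℝ))) *
        ((∫⁻ z, f z ^ r) ^ (1 / r) * volume B ^ (1 - 1 / r)) :=
        setLIntegral_mono' measurableSet_Ioc key
    _ = _ := by
        rw [lintegral_mul_const _ (by fun_prop), segmentConst]
        ring

theorem enorm_fderiv_apply_le {n : ℕ} (η : E d → E n) (z y : E d) :
    ‖fderiv ℝ η z y‖ₑ ≤
      ‖y‖ₑ * ∑ i, ‖fderiv ℝ η z (EuclideanSpace.single i (1 : ℝ))‖ₑ := by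
  have hy : y = ∑ i, y i • EuclideanSpace.single i (1 : ℝ) := by
    simpa using ((EuclideanSpace.basisFun (Fin d) ℝ).sum_repr y).symm
  conv_lhs => rw [hy, map_sum]
  refine (enorm_sum_le _ _).trans ?_
  rw [Finset.mul_sum]
  refine Finset.sum_le_sum fun i _ => ?_
  rw [map_smul, enorm_smul]
  gcongr
  rw [enorm_le_iff_norm_le]
  exact PiLp.norm_apply_le y i

/-- If `η` vanishes on `x + B`, then `η x` is minus the integral of the derivative of `η` along
each segment from `x` to a point of `x + B`; averaging over `B` gives a pointwise bound. -/
theorem measure_mul_enorm_le_segmentIntegral {n : ℕ} {η : E d → E n} (hη : ContDiff ℝ ∞ η)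
    {B : Set (E d)} (hB : MeasurableSet B) {ρ : ℝ} (hρ : ∀ y ∈ B, ‖y‖ ≤ ρ) {x : E d}
    (hx : ∀ y ∈ B, η (x + y) = 0) :
    volume B * ‖η x‖ₑ ≤ ENNReal.ofReal ρ * segmentIntegral B
      (fun z => ∑ i, ‖fderiv ℝ η z (EuclideanSpace.single i (1 : ℝ))‖ₑ) x := by
  set f : E d → ℝ≥0∞ := fun z => ∑ i, ‖fderiv ℝ η z (EuclideanSpace.single i (1 : ℝ))‖ₑ with hf
  have hc : Continuous (fderiv ℝ η) := hη.continuous_fderiv (by simp)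
  have hfm : Measurable f := by
    refine Finset.measurable_sum _ fun i _ => ?_
    exact (hc.clm_apply continuous_const).enorm.measurable
  have hy : ∀ y ∈ B, ‖η x‖ₑ ≤ ∫⁻ t in Ioc (0 : ℝ) 1, ENNReal.ofReal ρ * f (x + t • y) := by
    intro y hyB
    have hder : ∀ t : ℝ, HasDerivAt (fun t : ℝ => η (x + t • y)) (fderiv ℝ η (x + t • y) y) t := by
      intro t
      have h1 : HasDerivAt (fun t : ℝ => x + t • y) y t := by
        simpa using ((hasDerivAt_id t).smul_const y).const_add x
      exact ((hη.differentiable (by simp)) (x + t • y)).hasFDerivAt.comp_hasDerivAt t h1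
    have hcy : Continuous fun t : ℝ => fderiv ℝ η (x + t • y) y :=
      (hc.comp (by fun_prop)).clm_apply continuous_const
    have hint := intervalIntegral.integral_eq_sub_of_hasDerivAt (a := 0) (b := 1)
      (fun t _ => hder t) (hcy.intervalIntegrable _ _)
    rw [one_smul, hx y hyB, zero_smul, add_zero, zero_sub,
      intervalIntegral.integral_of_le zero_le_one] at hint
    calc ‖η x‖ₑ = ‖∫ t in Ioc (0 : ℝ) 1, fderiv ℝ η (x + t • y) y‖ₑ := by rw [hint, enorm_neg]
      _ ≤ ∫⁻ t in Ioc (0 : ℝ) 1, ‖fderiv ℝ η (x + t • y) y‖ₑ :=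
          enorm_integral_le_lintegral_enorm _
      _ ≤ _ := by
          refine lintegral_mono fun t => (enorm_fderiv_apply_le η _ y).trans ?_
          refine mul_le_mul_left ?_ _
          rw [← ofReal_norm]
          exact ENNReal.ofReal_le_ofReal (hρ y hyB)
  calc volume B * ‖η x‖ₑ = ∫⁻ _y in B, ‖η x‖ₑ := by
        rw [lintegral_const, Measure.restrict_apply_univ, mul_comm]
    _ ≤ ∫⁻ y in B, ∫⁻ t in Ioc (0 : ℝ) 1, ENNReal.ofReal ρ * f (x + t • y) :=
        setLIntegral_mono' hB hy
    _ = ∫⁻ t in Ioc (0 : ℝ) 1, ∫⁻ y in B, ENNReal.ofReal ρ * f (x + t • y) := by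
        refine lintegral_lintegral_swap (Measurable.aemeasurable ?_)
        exact (hfm.comp (by fun_prop)).const_mul _
    _ = _ := by
        rw [segmentIntegral, ← lintegral_const_mul' _ _ ENNReal.ofReal_ne_top]
        refine lintegral_congr fun t => ?_
        rw [lintegral_const_mul' _ _ ENNReal.ofReal_ne_top]

end SegmentAverage

section SupBound

variable {d n : ℕ} {Ω : Set (E d)}

/-- `u ∈ W^{1,2}(Ω)` is represented by the smooth function `η` with compact support in `Ω`. -/
def IsRepresentedBy (u : W12 Ω n) (η : E d → E n) : Prop :=
  ContDiff ℝ ∞ η ∧ HasCompactSupport η ∧ tsupport η ⊆ Ω ∧ toFun u =ᵐ[volume.restrict Ω] η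

theorem exists_isRepresentedBy_of_mem_span {u : W12 Ω n}
    (hu : u ∈ Submodule.span ℝ {u : W12 Ω n | ∃ η : E d → E n, IsRepresentedBy u η}) :
    ∃ η : E d → E n, IsRepresentedBy u η := by
  induction hu using Submodule.span_induction with
  | mem u h => exact h
  | zero =>
    exact ⟨0, contDiff_const, HasCompactSupport.zero, by simp, Lp.coeFn_zero _ _ _⟩
  | add u v _ _ hu hv =>
    obtain ⟨η, h1, h2, h3, h4⟩ := hu
    obtain ⟨ζ, k1, k2, k3, k4⟩ := hv
    refine ⟨η + ζ, h1.add k1, h2.add k2, (tsupport_add η ζ).trans (union_subset h3 k3), ?_⟩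
    exact (Lp.coeFn_add (toL2 u) (toL2 v)).trans (h4.add k4)
  | smul c u _ hu =>
    obtain ⟨η, h1, h2, h3, h4⟩ := hu
    refine ⟨c • η, h1.const_smul c, h2.smul_left (f := fun _ => c),
      (tsupport_smul_subset_right (fun _ => c) η).trans h3, ?_⟩
    exact (Lp.coeFn_smul c (toL2 u)).trans (h4.const_smul c)

/-- Elements of `W₀^{1,2}` are limits of smooth functions with compact support. -/
theorem exists_isRepresentedBy_edist_lt {e : W12 Ω n} (he : e ∈ W012 Ω n) {ε : ℝ≥0∞}
    (hε : 0 < ε) : ∃ (v : W12 Ω n) (η : E d → E n), IsRepresentedBy v η ∧ ‖e - v‖ₑ < ε := by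
  obtain ⟨v, hv, hev⟩ := EMetric.mem_closure_iff.1 he ε hε
  obtain ⟨η, hη⟩ := exists_isRepresentedBy_of_mem_span hv
  exact ⟨v, η, hη, by rwa [← edist_eq_enorm_sub]⟩

theorem IsRepresentedBy.deriv_ae_eq (hΩ : IsOpen Ω) {u : W12 Ω n} {η : E d → E n}
    (h : IsRepresentedBy u η) (i : Fin d) : u.1 (some i) =ᵐ[volume.restrict Ω]
      fun x => fderiv ℝ η x (EuclideanSpace.single i (1 : ℝ)) :=
  ((hasWeakDeriv_toFun u i).congr h.2.2.2 Filter.EventuallyEq.rfl).ae_eq hΩ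
    (hasWeakDeriv_of_contDiff η h.1 i)

/-- The extension by zero of `∑ᵢ |∂ᵢ u|`. -/
def gradSum (u : W12 Ω n) : E d → ℝ≥0∞ :=
  Ω.indicator fun x => ∑ i : Fin d, ‖u.1 (some i) x‖ₑ

theorem measurable_gradSum (hΩ : IsOpen Ω) (u : W12 Ω n) : Measurable (gradSum u) :=
  (Finset.measurable_sum _ fun i _ =>
    (Lp.stronglyMeasurable (u.1 (some i))).enorm).indicator hΩ.measurableSet

theorem gradNorm_one_le (u : W12 Ω n) :
    gradNorm 1 u ≤ volume Ω ^ (1 / 2 : ℝ) * (d * ‖u‖ₑ) := by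
  refine le_trans ?_ (mul_le_mul_right (gradNorm_two_le u) _)
  rw [gradNorm, gradNorm, Finset.mul_sum]
  exact Finset.sum_le_sum fun i _ => eLpNorm_one_le_eLpNorm_two _

/-- The extension by zero of `∑ᵢ |∂ᵢ e - ∂ᵢ η|`, for a smooth function `η`. -/
def gradDiff (e : W12 Ω n) (η : E d → E n) : E d → ℝ≥0∞ :=
  Ω.indicator fun x => ∑ i : Fin d,
    ‖e.1 (some i) x - fderiv ℝ η x (EuclideanSpace.single i (1 : ℝ))‖ₑ

theorem stronglyMeasurable_deriv_sub (e : W12 Ω n) {η : E d → E n} (hη : ContDiff ℝ ∞ η)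
    (i : Fin d) : StronglyMeasurable fun x =>
      e.1 (some i) x - fderiv ℝ η x (EuclideanSpace.single i (1 : ℝ)) := by
  have hc : Continuous fun x => fderiv ℝ η x (EuclideanSpace.single i (1 : ℝ)) :=
    (hη.continuous_fderiv (by simp)).clm_apply continuous_const
  exact (Lp.stronglyMeasurable _).sub hc.stronglyMeasurable

theorem measurable_gradDiff (hΩ : IsOpen Ω) (e : W12 Ω n) {η : E d → E n}
    (hη : ContDiff ℝ ∞ η) : Measurable (gradDiff e η) :=
  (Finset.measurable_sum _ fun i _ =>
    (stronglyMeasurable_deriv_sub e hη i).enorm).indicator hΩ.measurableSet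

theorem sum_enorm_fderiv_le (e : W12 Ω n) {η : E d → E n} (hη : tsupport η ⊆ Ω) (z : E d) :
    ∑ i, ‖fderiv ℝ η z (EuclideanSpace.single i (1 : ℝ))‖ₑ ≤ gradSum e z + gradDiff e η z := by
  by_cases hz : z ∈ Ω
  · simp only [gradSum, gradDiff, indicator_of_mem hz, ← Finset.sum_add_distrib]
    refine Finset.sum_le_sum fun i _ => ?_
    rw [← enorm_neg (e.1 (some i) z - _), neg_sub]
    refine le_trans (le_of_eq ?_) (enorm_add_le _ _)
    congr 1
    abel
  · have : fderiv ℝ η z = 0 := by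
      by_contra h0
      exact hz (hη (support_fderiv_subset ℝ h0))
    simp [this]

theorem lintegral_gradDiff_le (hΩ : IsOpen Ω) (e : W12 Ω n) {v : W12 Ω n} {η : E d → E n}
    (hη : IsRepresentedBy v η) :
    ∫⁻ x, gradDiff e η x ≤ volume Ω ^ (1 / 2 : ℝ) * (d * ‖e - v‖ₑ) := by
  refine le_trans (le_of_eq ?_) (gradNorm_one_le (e - v))
  unfold gradDiff
  rw [lintegral_indicator hΩ.measurableSet,
    lintegral_finsetSum _ fun i _ => (stronglyMeasurable_deriv_sub e hη.1 i).enorm, gradNorm]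
  refine Finset.sum_congr rfl fun i _ => ?_
  rw [eLpNorm_one_eq_lintegral_enorm]
  refine lintegral_congr_ae ?_
  filter_upwards [Lp.coeFn_sub (e.1 (some i)) (v.1 (some i)), hη.deriv_ae_eq hΩ i]
    with x hx1 hx2
  rw [show (e - v).1 (some i) = e.1 (some i) - v.1 (some i) from rfl, hx1, Pi.sub_apply, hx2]

theorem ae_enorm_sub_segmentIntegral_le (hΩ : IsOpen Ω) {B : Set (E d)}
    (hB : MeasurableSet B) (hB0 : volume B ≠ 0) (hBt : volume B ≠ ⊤) {ρ : ℝ}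
    (hρ : ∀ y ∈ B, ‖y‖ ≤ ρ) (hxB : ∀ x ∈ Ω, ∀ y ∈ B, x + y ∉ Ω) (e : W12 Ω n)
    {v : W12 Ω n} {η : E d → E n} (hη : IsRepresentedBy v η) :
    ∀ᵐ x ∂(volume.restrict Ω),
      ‖toFun e x‖ₑ - ENNReal.ofReal ρ / volume B * segmentIntegral B (gradSum e) x ≤
        ‖(e - v).1 none x‖ₑ +
          ENNReal.ofReal ρ / volume B * segmentIntegral B (gradDiff e η) x := by
  rw [ae_restrict_iff' hΩ.measurableSet]
  have h1 := (ae_restrict_iff' hΩ.measurableSet).1 (Lp.coeFn_sub (e.1 none) (v.1 none))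
  have h2 := (ae_restrict_iff' hΩ.measurableSet).1 hη.2.2.2
  filter_upwards [h1, h2] with x hx1 hx2 hx
  have h3 := measure_mul_enorm_le_segmentIntegral hη.1 hB hρ (x := x) fun y hy =>
    image_eq_zero_of_notMem_tsupport fun h => hxB x hx y hy (hη.2.2.1 h)
  have h5 := (segmentIntegral_mono B (sum_enorm_fderiv_le e hη.2.2.1) x).trans_eq
    (segmentIntegral_add B (measurable_gradSum hΩ e) x)
  have h4 : ‖η x‖ₑ ≤ ENNReal.ofReal ρ / volume B *
      (segmentIntegral B (gradSum e) x + segmentIntegral B (gradDiff e η) x) := by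
    rw [ENNReal.div_eq_inv_mul, mul_assoc]
    calc ‖η x‖ₑ = (volume B)⁻¹ * (volume B * ‖η x‖ₑ) := by
          rw [← mul_assoc, ENNReal.inv_mul_cancel hB0 hBt, one_mul]
      _ ≤ _ := mul_le_mul_right (h3.trans (mul_le_mul_right h5 _)) _
  have h6 : ‖toFun e x‖ₑ ≤ ‖(e - v).1 none x‖ₑ + ‖η x‖ₑ := by
    rw [show (e - v).1 none = e.1 none - v.1 none from rfl, hx1 hx, Pi.sub_apply, ← hx2 hx]
    refine le_trans (le_of_eq ?_) (enorm_add_le _ _)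
    congr 1
    exact (sub_add_cancel _ _).symm
  rw [tsub_le_iff_right]
  refine (h6.trans (add_le_add_right h4 _)).trans_eq ?_
  ring

/-- The pointwise bound by segment integrals holds for the smooth function `η`, and fails for `e` by
an amount that is controlled in `L¹` by the distance of `e` and `v`. -/
theorem lintegral_enorm_sub_segmentIntegral_le (hΩ : IsOpen Ω) {B : Set (E d)}
    (hB : MeasurableSet B) (hB0 : volume B ≠ 0) (hBt : volume B ≠ ⊤) {ρ : ℝ}
    (hρ : ∀ y ∈ B, ‖y‖ ≤ ρ) (hxB : ∀ x ∈ Ω, ∀ y ∈ B, x + y ∉ Ω) (e : W12 Ω n)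
    {v : W12 Ω n} {η : E d → E n} (hη : IsRepresentedBy v η) :
    ∫⁻ x in Ω, (‖toFun e x‖ₑ -
        ENNReal.ofReal ρ / volume B * segmentIntegral B (gradSum e) x) ≤
      (volume Ω ^ (1 / 2 : ℝ) + ENNReal.ofReal ρ / volume B *
        (volume B * (volume Ω ^ (1 / 2 : ℝ) * d))) * ‖e - v‖ₑ := by
  have hct : ENNReal.ofReal ρ / volume B ≠ ⊤ := ENNReal.div_ne_top ENNReal.ofReal_ne_top hB0
  have hDm := measurable_gradDiff hΩ e hη.1
  have hev1 : eLpNorm ((e - v).1 none) 1 (volume.restrict Ω) ≤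
      volume Ω ^ (1 / 2 : ℝ) * ‖e - v‖ₑ := by
    refine (eLpNorm_one_le_eLpNorm_two _).trans (mul_le_mul_right ?_ _)
    rw [← Lp.enorm_def, enorm_le_iff_norm_le]
    exact norm_toL2_le (e - v)
  have hev2 : ∫⁻ x in Ω, segmentIntegral B (gradDiff e η) x ≤
      volume B * (volume Ω ^ (1 / 2 : ℝ) * (d * ‖e - v‖ₑ)) := by
    refine (setLIntegral_le_lintegral Ω _).trans ?_
    rw [lintegral_segmentIntegral B hDm]
    exact mul_le_mul_right (lintegral_gradDiff_le hΩ e hη) _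
  refine (lintegral_mono_ae
    (ae_enorm_sub_segmentIntegral_le hΩ hB hB0 hBt hρ hxB e hη)).trans ?_
  rw [lintegral_add_right _ ((measurable_segmentIntegral B hDm).const_mul _),
    lintegral_const_mul' _ _ hct, ← eLpNorm_one_eq_lintegral_enorm]
  refine (add_le_add hev1 (mul_le_mul_right hev2 _)).trans_eq ?_
  ring

/-- The pointwise bound by segment integrals passes from smooth functions to their limits in
`W^{1,2}`, since `segmentIntegral B` is bounded on `L¹`. -/
theorem ae_enorm_le_segmentIntegral (hΩ : IsOpen Ω) (hΩb : Bornology.IsBounded Ω)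
    {B : Set (E d)} (hB : MeasurableSet B) (hB0 : volume B ≠ 0) (hBt : volume B ≠ ⊤) {ρ : ℝ}
    (hρ : ∀ y ∈ B, ‖y‖ ≤ ρ) (hxB : ∀ x ∈ Ω, ∀ y ∈ B, x + y ∉ Ω) {e : W12 Ω n}
    (he : e ∈ W012 Ω n) :
    ∀ᵐ x ∂(volume.restrict Ω), ‖toFun e x‖ₑ ≤
      ENNReal.ofReal ρ / volume B * segmentIntegral B (gradSum e) x := by
  have hct : ENNReal.ofReal ρ / volume B ≠ ⊤ := ENNReal.div_ne_top ENNReal.ofReal_ne_top hB0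
  have hv₀t : volume Ω ^ (1 / 2 : ℝ) ≠ ⊤ :=
    ENNReal.rpow_ne_top_of_nonneg (by norm_num) hΩb.measure_lt_top.ne
  have hCt := ENNReal.add_ne_top.2 ⟨hv₀t, ENNReal.mul_ne_top hct
    (ENNReal.mul_ne_top hBt (ENNReal.mul_ne_top hv₀t (ENNReal.natCast_ne_top d)))⟩
  -- subtraction in `ℝ≥0∞` is truncated: the integrand is the amount by which the bound fails
  have hzero : ∫⁻ x in Ω, (‖toFun e x‖ₑ -
      ENNReal.ofReal ρ / volume B * segmentIntegral B (gradSum e) x) = 0 := by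
    refine le_antisymm ?_ zero_le
    have ht := ENNReal.Tendsto.const_mul (Filter.tendsto_id (x := 𝓝 (0 : ℝ≥0∞))) (Or.inr hCt)
    rw [mul_zero] at ht
    refine ge_of_tendsto (ht.mono_left (nhdsWithin_le_nhds (s := Ioi 0))) ?_
    filter_upwards [self_mem_nhdsWithin] with ε hε
    obtain ⟨v, η, hη, hev⟩ := exists_isRepresentedBy_edist_lt he hε
    exact (lintegral_enorm_sub_segmentIntegral_le hΩ hB hB0 hBt hρ hxB e hη).trans
      (mul_le_mul_right hev.le _)
  have hm : Measurable fun x => ‖toFun e x‖ₑ -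
      ENNReal.ofReal ρ / volume B * segmentIntegral B (gradSum e) x :=
    (Lp.stronglyMeasurable (toL2 e)).enorm.sub
      ((measurable_segmentIntegral B (measurable_gradSum hΩ e)).const_mul _)
  filter_upwards [(lintegral_eq_zero_iff hm).1 hzero] with x hx
  exact tsub_eq_zero_iff_le.1 hx

theorem lintegral_gradSum_rpow_le (hΩ : IsOpen Ω) {r : ℝ} (hr : 1 ≤ r) (u : W12 Ω n) :
    (∫⁻ z, gradSum u z ^ r) ^ (1 / r) ≤ gradNorm (ENNReal.ofReal r) u := by
  have hr0 : 0 < r := by linarith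
  have h1 : ∫⁻ z, gradSum u z ^ r =
      ∫⁻ z in Ω, (∑ i : Fin d, ‖u.1 (some i) z‖ₑ) ^ r := by
    rw [← lintegral_indicator hΩ.measurableSet]
    refine lintegral_congr fun z => ?_
    by_cases hz : z ∈ Ω
    · simp [gradSum, hz]
    · simp [gradSum, hz, hr0]
  have h2 : (∫⁻ z in Ω, (∑ i : Fin d, ‖u.1 (some i) z‖ₑ) ^ r) ^ (1 / r) =
      eLpNorm (∑ i : Fin d, fun z => ‖u.1 (some i) z‖ₑ) (ENNReal.ofReal r)
        (volume.restrict Ω) := by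
    rw [eLpNorm_eq_eLpNorm' (by simpa using hr0) ENNReal.ofReal_ne_top,
      ENNReal.toReal_ofReal hr0.le]
    simp [eLpNorm']
  rw [h1, h2]
  refine (eLpNorm_sum_le
    (fun i _ => (Lp.stronglyMeasurable (u.1 (some i))).enorm.aestronglyMeasurable)
    (by simpa using hr)).trans (Finset.sum_le_sum fun i _ => ?_)
  exact (eLpNorm_enorm _).le

/-- On a bounded open set, functions in `W₀^{1,2}` whose gradient is in `L^q` with `q > d` are
bounded. No regularity of the boundary is needed. -/
theorem exists_eLpNorm_top_le_gradNorm (hd : 1 ≤ d) (hΩ : IsOpen Ω)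
    (hΩb : Bornology.IsBounded Ω) {q : ℝ≥0∞} (hqd : (d : ℝ≥0∞) < q) :
    ∃ C : ℝ≥0, ∀ e ∈ W012 Ω n, eLpNorm (toFun e) ⊤ (volume.restrict Ω) ≤ C * gradNorm q e := by
  -- a finite exponent between `d` and `q`
  set r : ℝ := (min q (d + 1)).toReal with hr
  have hmt : min q ((d : ℝ≥0∞) + 1) ≠ ⊤ :=
    ne_top_of_le_ne_top (by simp) (min_le_right _ _)
  have hrq : ENNReal.ofReal r ≤ q := by
    rw [hr, ENNReal.ofReal_toReal hmt]
    exact min_le_left _ _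
  have hdr : (d : ℝ) < r := by
    rw [hr, ← ENNReal.toReal_natCast d]
    refine (ENNReal.toReal_lt_toReal (by simp) hmt).2 (lt_min hqd ?_)
    exact ENNReal.lt_add_right (by simp) one_ne_zero
  have hd' : (1 : ℝ) ≤ d := by exact_mod_cast hd
  have hr1 : 1 ≤ r := by linarith
  obtain ⟨L, hL0, hL⟩ := hΩb.subset_ball_lt 0 0
  set y₀ : E d := EuclideanSpace.single ⟨0, hd⟩ (3 * L) with hy₀
  have hy₀n : ‖y₀‖ = 3 * L := by
    rw [hy₀, PiLp.norm_single, Real.norm_of_nonneg (by linarith)]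
  -- `Ω` lies in the ball of radius `L`, so that `x + B` misses `Ω` for all `x ∈ Ω`
  set B : Set (E d) := Metric.ball y₀ L with hBdef
  have hB0 : volume B ≠ 0 := (Metric.measure_ball_pos volume y₀ hL0).ne'
  have hBt : volume B ≠ ⊤ := measure_ball_lt_top.ne
  have hρ : ∀ y ∈ B, ‖y‖ ≤ 4 * L := by
    intro y hy
    rw [hBdef, mem_ball_iff_norm] at hy
    linarith [norm_le_norm_add_norm_sub' y y₀]
  have hxB : ∀ x ∈ Ω, ∀ y ∈ B, x + y ∉ Ω := by
    intro x hx y hy hxy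
    have h1 := mem_ball_zero_iff.1 (hL hx)
    have h2 := mem_ball_zero_iff.1 (hL hxy)
    rw [hBdef, mem_ball_iff_norm'] at hy
    have h3 : ‖y‖ ≤ ‖x + y‖ + ‖x‖ := by
      simpa using norm_sub_le (x + y) x
    linarith [norm_le_norm_add_norm_sub' y₀ y]
  set κ : ℝ≥0∞ := volume Ω ^ (1 / (ENNReal.ofReal r).toReal - 1 / q.toReal) with hκ
  have hqr : 1 / q.toReal ≤ 1 / (ENNReal.ofReal r).toReal := by
    rcases eq_or_ne q ⊤ with rfl | hqt
    · simp
    · refine one_div_le_one_div_of_le ?_ (ENNReal.toReal_mono hqt hrq)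
      rw [ENNReal.toReal_ofReal (by linarith)]
      linarith
  have hκt : κ ≠ ⊤ :=
    ENNReal.rpow_ne_top_of_nonneg (by linarith) hΩb.measure_lt_top.ne
  set C : ℝ≥0∞ := ENNReal.ofReal (4 * L) / volume B * (segmentConst B r * κ) with hC
  have hCt : C ≠ ⊤ := ENNReal.mul_ne_top (ENNReal.div_ne_top ENNReal.ofReal_ne_top hB0)
    (ENNReal.mul_ne_top (segmentConst_ne_top hBt hr1 hdr) hκt)
  refine ⟨C.toNNReal, fun e he => ?_⟩
  rw [ENNReal.coe_toNNReal hCt, eLpNorm_exponent_top]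
  refine essSup_le_of_ae_le _ ?_
  filter_upwards [ae_enorm_le_segmentIntegral hΩ hΩb measurableSet_ball hB0 hBt hρ hxB he]
    with x hx
  have hgrad : gradNorm (ENNReal.ofReal r) e ≤ κ * gradNorm q e := by
    rw [gradNorm, gradNorm, Finset.mul_sum]
    refine Finset.sum_le_sum fun i _ => ?_
    have := eLpNorm_le_eLpNorm_mul_rpow_measure_univ (μ := volume.restrict Ω) hrq
      (Lp.aestronglyMeasurable (e.1 (some i)))
    rwa [Measure.restrict_apply_univ, mul_comm] at this
  calc ‖toFun e x‖ₑ ≤ ENNReal.ofReal (4 * L) / volume B * segmentIntegral B (gradSum e) x := hx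
    _ ≤ ENNReal.ofReal (4 * L) / volume B * (segmentConst B r * (κ * gradNorm q e)) := by
        gcongr
        refine (segmentIntegral_le B (measurable_gradSum hΩ e) hr1 x).trans ?_
        gcongr
        exact (lintegral_gradSum_rpow_le hΩ hr1 e).trans hgrad
    _ = C * gradNorm q e := by
        rw [hC]
        ring

end SupBound

/-! ### Taylor expansion of the first variation -/

section Calculus

variable {V : Type*} [NormedAddCommGroup V] [NormedSpace ℝ V] {g : V → ℝ} {x : V}

theorem fderiv_fderiv_apply_eq (a b : V) :
    fderiv ℝ (fderiv ℝ g) x a b = iteratedFDeriv ℝ 2 g x ![a, b] := by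
  simp [iteratedFDeriv_two_apply]

theorem iteratedFDeriv_two_swap (hg : ContDiffAt ℝ 2 g x) (a b : V) :
    iteratedFDeriv ℝ 2 g x ![a, b] = iteratedFDeriv ℝ 2 g x ![b, a] := by
  rw [← fderiv_fderiv_apply_eq, ← fderiv_fderiv_apply_eq]
  exact hg.isSymmSndFDerivAt (by simp) a b

theorem hasFDerivAt_iteratedFDeriv_two (hg : ContDiffAt ℝ 3 g x) :
    HasFDerivAt (iteratedFDeriv ℝ 2 g) (fderiv ℝ (iteratedFDeriv ℝ 2 g) x) x :=
  ((hg.iteratedFDeriv_right (m := 1) (i := 2) (by norm_num)).differentiableAt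
    (by simp)).hasFDerivAt

theorem iteratedFDeriv_three_apply (a b c : V) :
    iteratedFDeriv ℝ 3 g x ![a, b, c] = fderiv ℝ (iteratedFDeriv ℝ 2 g) x a ![b, c] := by
  rw [iteratedFDeriv_succ_apply_left]
  rfl

theorem iteratedFDeriv_three_swap_right (hg : ContDiffAt ℝ 3 g x) (a b c : V) :
    iteratedFDeriv ℝ 3 g x ![a, b, c] = iteratedFDeriv ℝ 3 g x ![a, c, b] := by
  have key : ∀ m : Fin 2 → V, HasFDerivAt (fun y => iteratedFDeriv ℝ 2 g y m)
      ((ContinuousMultilinearMap.apply ℝ (fun _ : Fin 2 => V) ℝ m).comp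
        (fderiv ℝ (iteratedFDeriv ℝ 2 g) x)) x := fun m =>
    (ContinuousMultilinearMap.apply ℝ (fun _ : Fin 2 => V) ℝ m).hasFDerivAt.comp x
      (hasFDerivAt_iteratedFDeriv_two hg)
  have hev : (fun y => iteratedFDeriv ℝ 2 g y ![b, c]) =ᶠ[𝓝 x]
      fun y => iteratedFDeriv ℝ 2 g y ![c, b] := by
    filter_upwards [(hg.of_le (m := 2) (by norm_num)).eventually (by simp)] with y hy
    exact iteratedFDeriv_two_swap hy b c
  rw [iteratedFDeriv_three_apply, iteratedFDeriv_three_apply]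
  have := congrArg (fun L => L a) ((key ![b, c]).unique ((key ![c, b]).congr_of_eventuallyEq hev))
  simpa using this

theorem iteratedFDeriv_three_swap_left (hg : ContDiffAt ℝ 3 g x) (a b c : V) :
    iteratedFDeriv ℝ 3 g x ![a, b, c] = iteratedFDeriv ℝ 3 g x ![b, a, c] := by
  have h2 : ContDiffAt ℝ 2 (fderiv ℝ g) x := hg.fderiv_right (by norm_num)
  have h := h2.isSymmSndFDerivAt (by simp) a b
  have e : ∀ a b : V, iteratedFDeriv ℝ 3 g x ![a, b, c] =
      fderiv ℝ (fderiv ℝ (fderiv ℝ g)) x a b c := by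
    intro a b
    rw [iteratedFDeriv_succ_apply_right, iteratedFDeriv_two_apply]
    rfl
  rw [e, e, h]

theorem hasDerivAt_smul_const (e : V) (s : ℝ) : HasDerivAt (fun s : ℝ => s • e) e s := by
  simpa using (hasDerivAt_id s).smul_const e

theorem hasDerivAt_fderiv_line {e : V} {s : ℝ} (hg : ContDiffAt ℝ 2 g (s • e)) (Z : V) :
    HasDerivAt (fun s : ℝ => fderiv ℝ g (s • e) Z)
      (iteratedFDeriv ℝ 2 g (s • e) ![e, Z]) s := by
  have h1 : HasFDerivAt (fderiv ℝ g) (fderiv ℝ (fderiv ℝ g) (s • e)) (s • e) :=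
    ((hg.fderiv_right (m := 1) (by norm_num)).differentiableAt (by simp)).hasFDerivAt
  have h2 := h1.comp_hasDerivAt s (hasDerivAt_smul_const e s)
  rw [← fderiv_fderiv_apply_eq]
  exact ((ContinuousLinearMap.apply ℝ ℝ Z).hasFDerivAt.comp_hasDerivAt s h2)

theorem hasDerivAt_iteratedFDeriv_two_line {e : V} {s : ℝ} (hg : ContDiffAt ℝ 3 g (s • e))
    (Z : V) : HasDerivAt (fun s : ℝ => iteratedFDeriv ℝ 2 g (s • e) ![e, Z])
      (iteratedFDeriv ℝ 3 g (s • e) ![e, e, Z]) s := by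
  have h2 := (hasFDerivAt_iteratedFDeriv_two hg).comp_hasDerivAt s (hasDerivAt_smul_const e s)
  rw [iteratedFDeriv_three_apply]
  exact ((ContinuousMultilinearMap.apply ℝ (fun _ : Fin 2 => V) ℝ
    ![e, Z]).hasFDerivAt.comp_hasDerivAt s h2)

theorem abs_fderiv_sub_le {e Z : V} {M : ℝ}
    (hg : ∀ s ∈ Icc (0 : ℝ) 1, ContDiffAt ℝ 2 g (s • e))
    (hM : ∀ s ∈ Icc (0 : ℝ) 1, |iteratedFDeriv ℝ 2 g (s • e) ![e, Z]| ≤ M) :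
    |fderiv ℝ g e Z - fderiv ℝ g 0 Z| ≤ M := by
  have := norm_image_sub_le_of_norm_deriv_le_segment_01'
    (f := fun s : ℝ => fderiv ℝ g (s • e) Z)
    (fun s hs => (hasDerivAt_fderiv_line (hg s hs) Z).hasDerivWithinAt)
    fun s hs => hM s ⟨hs.1, hs.2.le⟩
  simpa using this

/-- The error of the first-order Taylor expansion of `s ↦ Dg(s e)(W)` between `0` and `1`. -/
theorem abs_fderiv_sub_sub_le {e W : V} {M : ℝ}
    (hg : ∀ s ∈ Icc (0 : ℝ) 1, ContDiffAt ℝ 3 g (s • e))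
    (hM : ∀ s ∈ Icc (0 : ℝ) 1, |iteratedFDeriv ℝ 3 g (s • e) ![W, e, e]| ≤ M) :
    |fderiv ℝ g e W - fderiv ℝ g 0 W - iteratedFDeriv ℝ 2 g 0 ![e, W]| ≤ M := by
  have hM0 : 0 ≤ M := (abs_nonneg _).trans (hM 0 (by simp))
  have hM' : ∀ s ∈ Icc (0 : ℝ) 1, ‖iteratedFDeriv ℝ 3 g (s • e) ![e, e, W]‖ ≤ M := by
    intro s hs
    rw [iteratedFDeriv_three_swap_right (hg s hs), iteratedFDeriv_three_swap_left (hg s hs)]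
    exact hM s hs
  have h2 : ∀ s ∈ Icc (0 : ℝ) 1, ‖iteratedFDeriv ℝ 2 g (s • e) ![e, W] -
      iteratedFDeriv ℝ 2 g 0 ![e, W]‖ ≤ M := by
    intro s hs
    have := norm_image_sub_le_of_norm_deriv_le_segment'
      (f := fun s : ℝ => iteratedFDeriv ℝ 2 g (s • e) ![e, W]) (a := 0) (b := 1) (C := M)
      (fun s hs => (hasDerivAt_iteratedFDeriv_two_line (hg s hs) W).hasDerivWithinAt)
      (fun s hs => hM' s ⟨hs.1, hs.2.le⟩) s hs
    rw [zero_smul, sub_zero] at this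
    exact this.trans (mul_le_of_le_one_right hM0 hs.2)
  have := norm_image_sub_le_of_norm_deriv_le_segment_01'
    (f := fun s : ℝ => fderiv ℝ g (s • e) W - s * iteratedFDeriv ℝ 2 g 0 ![e, W])
    (fun s hs => ((hasDerivAt_fderiv_line ((hg s hs).of_le (by norm_num)) W).sub
      ((hasDerivAt_id s).mul_const _)).hasDerivWithinAt)
    fun s hs => by
      rw [one_mul]
      exact h2 s ⟨hs.1, hs.2.le⟩
  rw [Real.norm_eq_abs] at this
  convert this using 2
  simp
  ring

end Calculus

/-! ### The duality argument -/

section AbstractDuality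

variable {X : Type*} [NormedAddCommGroup X] [NormedSpace ℝ X] {S : Submodule ℝ X} {J : X → ℝ}
  {H : Set X}

theorem iteratedFDeriv_translate (k : ℕ) (u : X) (Y : S) :
    iteratedFDeriv ℝ k (fun Z : S => J (u + Z)) Y =
      iteratedFDeriv ℝ k (fun Z : S => J (u + Y + Z)) 0 := by
  have h : (fun Z : S => J (u + Y + Z)) = fun Z => (fun Z : S => J (u + Z)) (Y + Z) := by
    funext Z
    simp [add_assoc]
  have h2 := iteratedFDeriv_comp_add_left (𝕜 := ℝ) (f := fun Z : S => J (u + Z)) k Y 0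
  rw [add_zero] at h2
  rw [h]
  exact h2.symm

theorem contDiffAt_translate {k : ℕ} (hJ : ∀ v ∈ H, ContDiffAt ℝ k (fun Z : S => J (v + Z)) 0)
    {u : X} {Y : S} (h : u + (Y : X) ∈ H) : ContDiffAt ℝ k (fun Z : S => J (u + Z)) Y := by
  have h1 := hJ _ h
  have h2 : (fun Z : S => J (u + Z)) = (fun V : S => J (u + Y + V)) ∘ fun Z => Z - Y := by
    funext Z
    simp [add_assoc]
  rw [h2]
  refine ContDiffAt.comp Y ?_ (contDiffAt_id.sub contDiffAt_const)
  simpa using h1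

/-- The first variation vanishes at a minimizer. -/
theorem fderiv_eq_zero_of_isMinOn (hH : ∀ v ∈ H, ∀ᶠ Y : S in 𝓝 0, v + (Y : X) ∈ H) {u : X}
    (hu : u ∈ H) (hmin : IsMinOn J H u) : fderiv ℝ (fun Z : S => J (u + Z)) 0 = 0 := by
  refine IsLocalMin.fderiv_eq_zero ?_
  filter_upwards [hH u hu] with Y hY
  simpa using hmin hY

/-- The first variation at a local minimizer in an affine subspace vanishes in the directions of
this subspace. -/
theorem fderiv_apply_eq_zero_of_isLocalMinOn
    (hH : ∀ v ∈ H, ∀ᶠ Y : S in 𝓝 0, v + (Y : X) ∈ H) {A : AffineSubspace ℝ X} {u uh : X}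
    (huh : uh ∈ H ∩ A) (hmin : IsLocalMinOn J (H ∩ A) uh) {e : S} (he : u + e = uh)
    (hd : DifferentiableAt ℝ (fun Z : S => J (u + Z)) e) {V : S}
    (hV : (V : X) ∈ A.direction) : fderiv ℝ (fun Z : S => J (u + Z)) e V = 0 := by
  have hl : HasDerivAt (fun t : ℝ => e + t • V) V 0 := (hasDerivAt_smul_const V 0).const_add e
  have hder : HasDerivAt (fun t : ℝ => J (u + ((e + t • V : S) : X)))
      (fderiv ℝ (fun Z : S => J (u + Z)) e V) 0 := by
    have h0 : HasFDerivAt (fun Z : S => J (u + Z))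
        (fderiv ℝ (fun Z : S => J (u + Z)) e) (e + (0 : ℝ) • V) := by
      simpa using hd.hasFDerivAt
    exact h0.comp_hasDerivAt (0 : ℝ) hl
  refine IsLocalMin.hasDerivAt_eq_zero ?_ hder
  have heq : ∀ t : ℝ, u + ((e + t • V : S) : X) = uh + ((t • V : S) : X) := by
    intro t
    rw [← he]
    simp [add_assoc]
  have hc : Continuous fun t : ℝ => t • V := by fun_prop
  have ht0 : Filter.Tendsto (fun t : ℝ => t • V) (𝓝 0) (𝓝 0) := by
    simpa using hc.tendsto 0
  have hmem : ∀ᶠ t : ℝ in 𝓝 0, uh + ((t • V : S) : X) ∈ H ∩ A := by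
    filter_upwards [ht0.eventually (hH uh huh.1)] with t ht
    refine ⟨ht, ?_⟩
    have := AffineSubspace.vadd_mem_of_mem_direction (A.direction.smul_mem t hV) huh.2
    rwa [vadd_eq_add, add_comm] at this
  have hto : Filter.Tendsto (fun t : ℝ => uh + ((t • V : S) : X)) (𝓝 0) (𝓝[H ∩ A] uh) := by
    refine tendsto_nhdsWithin_iff.2 ⟨?_, hmem⟩
    have : Continuous fun t : ℝ => uh + ((t • V : S) : X) := by fun_prop
    simpa using this.tendsto 0
  filter_upwards [hto.eventually hmin] with t ht
  rw [heq, heq]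
  simpa using ht

/-- The core of the Aubin–Nitsche estimate: `δ²J(u)(W, e)` is the second-order term in the Taylor
expansion of `s ↦ δJ(u + s e)(W)` at `s = 0`. The zeroth-order term vanishes because `u` is a
minimizer, and the value at `s = 1` does not change if an element of the direction of `A` is
subtracted from `W`. -/
theorem neg_variation_le (hH : ∀ v ∈ H, ∀ᶠ Y : S in 𝓝 0, v + (Y : X) ∈ H) (hconv : Convex ℝ H)
    {Lam : ℝ} (hJ2 : ∀ v ∈ H, ∀ V W : S,
      |iteratedFDeriv ℝ 2 (fun Z : S => J (v + Z)) 0 ![V, W]| ≤ Lam * ‖V‖ * ‖W‖)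
    (hJ3 : ∀ v ∈ H, ContDiffAt ℝ (3 : ℕ) (fun Z : S => J (v + Z)) 0) {u : X} (hu : u ∈ H)
    (hmin : IsMinOn J H u) {A : AffineSubspace ℝ X} {uh : X} (huh : uh ∈ H ∩ A)
    (hminh : IsLocalMinOn J (H ∩ A) uh) {e : S} (he : u + e = uh) {W WI : S}
    (hWI : (WI : X) ∈ A.direction) {M : ℝ}
    (hM : ∀ s ∈ Icc (0 : ℝ) 1, u + s • (e : X) ∈ H →
      |iteratedFDeriv ℝ 3 (fun Z : S => J (u + s • (e : X) + Z)) 0 ![W, e, e]| ≤ M) :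
    -iteratedFDeriv ℝ 2 (fun Z : S => J (u + Z)) 0 ![W, e] ≤
      Lam * ‖(e : X)‖ * ‖(W : X) - WI‖ + M := by
  have hsH : ∀ s ∈ Icc (0 : ℝ) 1, u + ((s • e : S) : X) ∈ H := by
    intro s hs
    have := hconv.add_smul_sub_mem hu huh.1 hs
    rwa [← he, add_sub_cancel_left] at this
  have hc3 : ∀ s ∈ Icc (0 : ℝ) 1, ContDiffAt ℝ 3 (fun Z : S => J (u + Z)) (s • e) := by
    intro s hs
    exact_mod_cast contDiffAt_translate hJ3 (hsH s hs)
  have hc2 : ∀ s ∈ Icc (0 : ℝ) 1, ContDiffAt ℝ 2 (fun Z : S => J (u + Z)) (s • e) :=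
    fun s hs => (hc3 s hs).of_le (by norm_num)
  have h3 := abs_fderiv_sub_sub_le (W := W) (M := M) hc3 fun s hs => by
    rw [iteratedFDeriv_translate]
    exact hM s hs (hsH s hs)
  have h2 := abs_fderiv_sub_le (Z := W - WI) (M := Lam * ‖e‖ * ‖W - WI‖) hc2 fun s hs => by
    rw [iteratedFDeriv_translate]
    exact hJ2 _ (hsH s hs) e (W - WI)
  -- the first variation at `u` vanishes in all directions, that at `uh` in the direction `WI`
  have hz0 := fderiv_eq_zero_of_isMinOn hH hu hmin
  have hde : DifferentiableAt ℝ (fun Z : S => J (u + Z)) e := by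
    have := hc2 1 (by simp)
    rw [one_smul] at this
    exact this.differentiableAt (by simp)
  have hz1 := fderiv_apply_eq_zero_of_isLocalMinOn hH huh hminh he hde hWI
  have hc20 := hc2 0 (by simp)
  rw [zero_smul] at hc20
  rw [hz0, iteratedFDeriv_two_swap hc20] at h3
  rw [hz0, map_sub, hz1] at h2
  simp only [zero_apply, sub_zero] at h2 h3
  change _ ≤ Lam * ‖e‖ * ‖W - WI‖ + M
  linarith [(abs_le.1 h3).2, (abs_le.1 h2).1]

/-- The Lax–Milgram theorem for a coercive second derivative on a complete subspace of a space whose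
norm satisfies the parallelogram law. -/
theorem exists_iteratedFDeriv_two_eq
    (hpar : ∀ x y : X, ‖x + y‖ ^ 2 + ‖x - y‖ ^ 2 = 2 * (‖x‖ ^ 2 + ‖y‖ ^ 2))
    [CompleteSpace S] {g : S → ℝ} {lam : ℝ} (hlam : 0 < lam)
    (hg : ∀ V : S, lam * ‖V‖ ^ 2 ≤ iteratedFDeriv ℝ 2 g 0 ![V, V]) (ℓ : X →ₗ[ℝ] ℝ) {C : ℝ}
    (hℓ : ∀ v, ‖ℓ v‖ ≤ C * ‖v‖) :
    ∃ W : S, ∀ V : S, iteratedFDeriv ℝ 2 g 0 ![W, V] = ℓ V := by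
  -- the inner product is recovered from the norm, so that its topology is the given one
  let _ : InnerProductSpace ℝ S := InnerProductSpace.ofNorm ℝ fun x y => by
    have h := hpar x y
    simp only [pow_two] at h
    exact h
  have hco : IsCoercive (fderiv ℝ (fderiv ℝ g) 0) := ⟨lam, hlam, fun V => by
    rw [fderiv_fderiv_apply_eq]
    simpa [pow_two, mul_assoc] using hg V⟩
  obtain ⟨W, hW⟩ := hco.continuousLinearEquivOfBilin.surjective
    ((InnerProductSpace.toDual ℝ S).symm ((ℓ.mkContinuous C hℓ).comp S.subtypeL))
  refine ⟨W, fun V => ?_⟩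
  rw [← fderiv_fderiv_apply_eq, ← hco.continuousLinearEquivOfBilin_apply, hW,
    InnerProductSpace.toDual_symm_apply]
  rfl

theorem eventually_add_mem_of_isOpen {φ : X} {O : Set X} (hO : IsOpen O)
    (hH : H = O ∩ {v | v - φ ∈ S}) (v : X) (hv : v ∈ H) :
    ∀ᶠ Y : S in 𝓝 0, v + (Y : X) ∈ H := by
  subst hH
  have hc : Continuous fun Y : S => v + (Y : X) := by fun_prop
  have h0 : v + ((0 : S) : X) ∈ O := by
    rw [Submodule.coe_zero, add_zero]
    exact hv.1
  filter_upwards [hc.continuousAt.eventually_mem (hO.mem_nhds h0)] with Y hY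
  refine ⟨hY, ?_⟩
  have := S.add_mem hv.2 Y.2
  rwa [← add_sub_right_comm] at this

end AbstractDuality

section Duality

variable {d n : ℕ} {Ω : Set (E d)} {φ : W12 Ω n} {H : Set (W12 Ω n)} {J : W12 Ω n → ℝ}

theorem IsAdmissible.subset_WBdry (hH : IsAdmissible φ H) : H ⊆ WBdry φ := by
  obtain ⟨O, _, h⟩ := hH.exists_open
  rw [h]
  exact inter_subset_right

theorem sub_mem_W012 {u v : W12 Ω n} (hu : u ∈ WBdry φ) (hv : v ∈ WBdry φ) :
    u - v ∈ W012 Ω n := by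
  have := (W012 Ω n).sub_mem hu hv
  rwa [sub_sub_sub_cancel_right] at this

theorem norm_parallelogram (v w : W12 Ω n) :
    ‖v + w‖ ^ 2 + ‖v - w‖ ^ 2 = 2 * (‖v‖ ^ 2 + ‖w‖ ^ 2) :=
  parallelogram_law_with_norm ℝ v.1 w.1

/-- The linear functional `v ↦ -(v, f)_{L²}` on `W^{1,2}`. -/
def negInnerL2 (f : Lp (E n) 2 (volume.restrict Ω)) : W12 Ω n →ₗ[ℝ] ℝ where
  toFun v := -inner ℝ (toL2 v) f
  map_add' v w := by
    rw [show toL2 (v + w) = toL2 v + toL2 w from rfl, inner_add_left, neg_add]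
  map_smul' c v := by
    rw [show toL2 (c • v) = c • toL2 v from rfl, real_inner_smul_left, RingHom.id_apply,
      smul_eq_mul, mul_neg]

theorem norm_negInnerL2_le (f : Lp (E n) 2 (volume.restrict Ω)) (v : W12 Ω n) :
    ‖negInnerL2 f v‖ ≤ ‖f‖ * ‖v‖ := by
  change ‖-inner ℝ (toL2 v) f‖ ≤ _
  rw [norm_neg]
  refine (norm_inner_le_norm _ _).trans ?_
  rw [mul_comm]
  exact mul_le_mul_of_nonneg_left (norm_toL2_le _) (norm_nonneg _)

set_option maxHeartbeats 1000000 in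
theorem exists_adjoint_solution (hΩb : Bornology.IsBounded Ω) {lam Lam : ℝ} (hlam : 0 < lam)
    (hJ : IsElliptic J H lam Lam) {u : W12 Ω n} (hu : u ∈ H)
    (f : Lp (E n) 2 (volume.restrict Ω)) :
    ∃ W : W012 Ω n, ∀ V : W012 Ω n,
      variation2 J u W V = -inner ℝ (toL2 (V : W12 Ω n)) f := by
  have := completeSpace_W012 (n := n) hΩb
  exact exists_iteratedFDeriv_two_eq (X := W12 Ω n) (S := W012 Ω n)
    (g := fun Z : W012 Ω n => J (u + Z)) norm_parallelogram hlam (hJ.coercive u hu)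
    (negInnerL2 f) (C := ‖f‖) (norm_negInnerL2_le f)

theorem IsAdmissible.eventually_add_mem (hH : IsAdmissible φ H) (v : W12 Ω n) (hv : v ∈ H) :
    ∀ᶠ Z : W012 Ω n in 𝓝 0, v + (Z : W12 Ω n) ∈ H := by
  obtain ⟨O, hO, h⟩ := hH.exists_open
  exact eventually_add_mem_of_isOpen (X := W12 Ω n) (S := W012 Ω n) (φ := φ) (H := H) (O := O)
    hO h v hv

set_option maxHeartbeats 1000000 in
theorem neg_variation2_le (hH : IsAdmissible φ H) {lam Lam : ℝ} (hJ : IsElliptic J H lam Lam)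
    (hJ3 : IsCk 3 J H) {u : W12 Ω n} (hu : u ∈ H) (hmin : IsMinOn J H u)
    {A : AffineSubspace ℝ (W12 Ω n)} {uh : W12 Ω n} (huh : uh ∈ H ∩ (A : Set (W12 Ω n)))
    (hminh : IsLocalMinOn J (H ∩ (A : Set (W12 Ω n))) uh) {e : W012 Ω n} (he : u + e = uh)
    {W WI : W012 Ω n} (hWI : (WI : W12 Ω n) ∈ A.direction) {M : ℝ}
    (hM : ∀ s ∈ Icc (0 : ℝ) 1, u + s • (e : W12 Ω n) ∈ H →
      |variation3 J (u + s • (e : W12 Ω n)) W e e| ≤ M) :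
    -variation2 J u W e ≤ Lam * ‖(e : W12 Ω n)‖ * ‖(W : W12 Ω n) - WI‖ + M :=
  neg_variation_le (X := W12 Ω n) (S := W012 Ω n) (J := J) (H := H) (u := u) (uh := uh) (e := e)
    (W := W) (WI := WI) (A := A) hH.eventually_add_mem hH.convex hJ.bounded hJ3 hu hmin huh hminh
    he hWI hM

theorem ThirdVariationBound.abs_le {q : ℝ≥0∞} {K : ℝ≥0 → ℝ≥0} {N : W012 Ω n → ℝ≥0∞}
    (h : ThirdVariationBound J H q K N) {R : ℝ≥0} {v : W12 Ω n} (hv : v ∈ H)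
    (hR : sobolevNorm Ω 1 q (toFun v) ≤ R) {U V : W012 Ω n}
    (hU : sobolevNorm Ω 2 2 (toFun (U : W12 Ω n)) ≠ ⊤) (hV : N V ≠ ⊤) :
    |variation3 J v U V V| ≤ K R * (sobolevNorm Ω 2 2 (toFun (U : W12 Ω n))).toReal *
      ‖(V : W12 Ω n)‖ * (N V).toReal :=
  h R v hv hR U hU V hV

theorem toReal_enorm_W012 (V : W012 Ω n) : (‖V‖ₑ).toReal = ‖(V : W12 Ω n)‖ :=
  toReal_enorm V

theorem enorm_W012_ne_top (V : W012 Ω n) : ‖V‖ₑ ≠ ⊤ := enorm_ne_top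

end Duality

/-! ### Comparison and interpolation of `L^p` norms -/

section LpNorms

variable {d n : ℕ} {Ω : Set (E d)}

theorem rpow_le_one_add (a : ℝ≥0∞) {x : ℝ} (h0 : 0 ≤ x) (h1 : x ≤ 1) : a ^ x ≤ 1 + a := by
  rcases le_total a 1 with ha | ha
  · exact (ENNReal.rpow_le_one ha h0).trans le_self_add
  · exact ((ENNReal.rpow_le_rpow_of_exponent_le ha h1).trans_eq (ENNReal.rpow_one a)).trans
      le_add_self

/-- On a set of finite measure, `L^q` embeds into `L^p` for `p ≤ q`, with a constant that does not
depend on `p` and `q`. -/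
theorem eLpNorm_le_eLpNorm_of_exponent_le {p q : ℝ≥0∞} (hp : 1 ≤ p) (hpq : p ≤ q)
    {f : E d → E n} (hf : AEStronglyMeasurable f (volume.restrict Ω)) :
    eLpNorm f p (volume.restrict Ω) ≤ (1 + volume Ω) * eLpNorm f q (volume.restrict Ω) := by
  refine (eLpNorm_le_eLpNorm_mul_rpow_measure_univ hpq hf).trans ?_
  rw [Measure.restrict_apply_univ, mul_comm]
  rcases eq_or_ne p ⊤ with rfl | hpt
  · rw [top_le_iff.1 hpq]
    simp only [sub_self, ENNReal.rpow_zero]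
    gcongr
    exact le_self_add
  have hp1 : 1 ≤ p.toReal := by
    simpa using (ENNReal.toReal_le_toReal ENNReal.one_ne_top hpt).2 hp
  have hp2 : 1 / p.toReal ≤ 1 := by
    rw [div_le_one (by linarith)]
    exact hp1
  have hq : 1 / q.toReal ≤ 1 / p.toReal := by
    rcases eq_or_ne q ⊤ with rfl | hqt
    · simp
    · exact one_div_le_one_div_of_le (by linarith) ((ENNReal.toReal_le_toReal hpt hqt).2 hpq)
  have hq0 : 0 ≤ 1 / q.toReal := by positivity
  gcongr
  exact rpow_le_one_add _ (by linarith) (by linarith)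

/-- Interpolation of `L^r` between `L²` and `L^∞`. -/
theorem eLpNorm_le_interpolate {r : ℝ} (hr : 2 ≤ r) {f : E d → E n}
    (hBt : eLpNorm f ⊤ (volume.restrict Ω) ≠ ⊤) :
    eLpNorm f (ENNReal.ofReal r) (volume.restrict Ω) ≤
      eLpNorm f ⊤ (volume.restrict Ω) ^ (1 - 2 / r) *
        eLpNorm f 2 (volume.restrict Ω) ^ (2 / r) := by
  have hr0 : 0 < r := by linarith
  set B := eLpNorm f ⊤ (volume.restrict Ω) with hB
  rw [eLpNorm_eq_lintegral_rpow_enorm_toReal (by simpa using hr0) ENNReal.ofReal_ne_top,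
    eLpNorm_eq_lintegral_rpow_enorm_toReal two_ne_zero ENNReal.ofNat_ne_top,
    ENNReal.toReal_ofReal hr0.le, ENNReal.toReal_ofNat]
  have h1 : ∫⁻ x in Ω, ‖f x‖ₑ ^ r ≤ B ^ (r - 2) * ∫⁻ x in Ω, ‖f x‖ₑ ^ (2 : ℝ) := by
    rw [← lintegral_const_mul' _ _ (ENNReal.rpow_ne_top_of_nonneg (by linarith) hBt)]
    refine lintegral_mono_ae ?_
    filter_upwards [ae_le_eLpNormEssSup (f := f) (μ := volume.restrict Ω)] with x hx
    calc ‖f x‖ₑ ^ r = ‖f x‖ₑ ^ (r - 2) * ‖f x‖ₑ ^ (2 : ℝ) := by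
          rw [← ENNReal.rpow_add_of_nonneg _ _ (by linarith) (by norm_num), sub_add_cancel]
      _ ≤ B ^ (r - 2) * ‖f x‖ₑ ^ (2 : ℝ) := by
          refine mul_le_mul_left (ENNReal.rpow_le_rpow ?_ (by linarith)) _
          rw [hB, eLpNorm_exponent_top]
          exact hx
  refine (ENNReal.rpow_le_rpow h1 (by positivity)).trans_eq ?_
  rw [ENNReal.mul_rpow_of_nonneg _ _ (by positivity), ← ENNReal.rpow_mul, ← ENNReal.rpow_mul]
  congr 2
  · field_simp
  · field_simp

end LpNorms

/-! ### Powers of the mesh width -/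

section MeshWidth

variable {h h₀ : ℝ}

theorem rpow_le_max_pow (hh : 0 < h) (hh₀ : h ≤ h₀) {x : ℝ} {m : ℕ} (hx : 0 ≤ x) (hxm : x ≤ m) :
    h ^ x ≤ max 1 h₀ ^ m := by
  calc h ^ x ≤ max 1 h₀ ^ x := Real.rpow_le_rpow hh.le (hh₀.trans (le_max_right _ _)) hx
    _ ≤ max 1 h₀ ^ (m : ℝ) := Real.rpow_le_rpow_of_exponent_le (le_max_left _ _) hxm
    _ = max 1 h₀ ^ m := Real.rpow_natCast _ _

theorem pow_le_mul_of_one_le (hh : 0 < h) (hh₀ : h ≤ h₀) {m : ℕ} (hm : 1 ≤ m) :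
    h ^ m ≤ max 1 h₀ ^ m * h := by
  obtain ⟨k, rfl⟩ := Nat.exists_eq_add_of_le' hm
  rw [pow_succ]
  refine mul_le_mul_of_nonneg_right ?_ hh.le
  have := rpow_le_max_pow hh hh₀ (x := k) (m := k + 1) (by positivity) (by push_cast; linarith)
  rwa [Real.rpow_natCast] at this

/-- The exponent in the inverse estimate between `L²` and `L^q` is at most `m`. For `d ≤ 2 m` this
holds for all `q`, and for `d = 2 m + 1` exactly for `q ≤ 2 d`. -/
theorem inverse_exponent_le {d m : ℕ} (hd : 1 ≤ d) (hdm : d < 2 * (m + 1)) {q : ℝ≥0∞}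
    (hq0 : 2 < q) (hq : d = 2 * m + 1 → q ≤ 2 * d) :
    (d : ℝ) * max 0 ((2 : ℝ≥0∞).toReal⁻¹ - q.toReal⁻¹) ≤ m := by
  have hd0 : (0 : ℝ) < d := by exact_mod_cast hd
  have hq1 : 0 ≤ q.toReal⁻¹ := by positivity
  rcases max_cases 0 ((2 : ℝ≥0∞).toReal⁻¹ - q.toReal⁻¹) with ⟨h1, _⟩ | ⟨h1, _⟩
  · rw [h1, mul_zero]
    positivity
  rw [h1, ENNReal.toReal_ofNat]
  by_cases hdd : d ≤ 2 * m
  · have : (d : ℝ) ≤ 2 * m := by exact_mod_cast hdd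
    nlinarith
  · have hdd' : d = 2 * m + 1 := by omega
    have hql := hq hdd'
    have hqt : q ≠ ⊤ := ne_top_of_le_ne_top (by finiteness) hql
    have hqr : q.toReal ≤ 2 * d := by
      have := ENNReal.toReal_mono (by finiteness) hql
      simpa using this
    have hq2 : 0 < q.toReal := ENNReal.toReal_pos (by positivity) hqt
    have h3 : (2 * (d : ℝ))⁻¹ ≤ q.toReal⁻¹ := inv_anti₀ hq2 hqr
    have h4 : (d : ℝ) * (2 * (d : ℝ))⁻¹ = 1 / 2 := by field_simp
    have h5 : (d : ℝ) = 2 * m + 1 := by exact_mod_cast hdd'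
    nlinarith [mul_le_mul_of_nonneg_left h3 hd0.le]

/-- Absorption: the exponents are such that `h^m (h^{m+1})^{2/d}` is at most of the order `h^{m+1}`,
since `d ≤ 2 (m + 1)`, while the power `2/d < 1` of `X` can be absorbed. -/
theorem le_of_le_add_rpow {d m : ℕ} (hd : 3 ≤ d) (hdm : d < 2 * (m + 1)) (hh : 0 < h)
    (hh₀ : h ≤ h₀) {a b X : ℝ} (ha : 0 ≤ a) (hb : 0 ≤ b) (hX : 0 ≤ X)
    (hle : X ≤ a * h ^ (m + 1) + b * (h ^ m * X ^ (2 / d : ℝ))) :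
    X ≤ max 1 ((a + b * max 1 h₀ ^ m) ^ 3) * h ^ (m + 1) := by
  set τ : ℝ := h ^ (m + 1) with hτ
  set A : ℝ := max 1 h₀ ^ m with hA
  set θ : ℝ := 2 / d with hθ
  have hd3 : (3 : ℝ) ≤ d := by exact_mod_cast hd
  have hdm' : (d : ℝ) ≤ 2 * (m + 1) := by exact_mod_cast hdm.le
  have hθ0 : 0 ≤ θ := by positivity
  have hθ1 : θ ≤ 2 / 3 := by
    rw [hθ, div_le_div_iff₀ (by linarith) (by norm_num)]
    linarith
  have hθ2 : 1 ≤ (m + 1) * θ := by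
    rw [hθ, mul_div_assoc', le_div_iff₀ (by linarith)]
    linarith
  have hτ0 : 0 < τ := by positivity
  have hA0 : 0 < A := pow_pos (lt_max_of_lt_left one_pos) m
  -- the claim is a bound of `Y = X / h^{m+1}` that does not depend on `h`
  set Y : ℝ := X / τ with hY
  have hXY : X = τ * Y := by
    rw [hY]
    field_simp
  have hY0 : 0 ≤ Y := by positivity
  have hpow : h ^ m * X ^ θ ≤ τ * (A * Y ^ θ) := by
    have h1 : τ ^ θ = h * h ^ ((m + 1) * θ - 1) := by
      rw [hτ, ← Real.rpow_natCast, ← Real.rpow_mul hh.le]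
      conv_rhs => rw [← Real.rpow_one_add' hh.le (by linarith)]
      push_cast
      congr 1
      ring
    have h2 : h ^ ((m + 1) * θ - 1) ≤ A := by
      refine rpow_le_max_pow hh hh₀ (by linarith) ?_
      nlinarith
    rw [hXY, Real.mul_rpow hτ0.le hY0, h1]
    calc h ^ m * (h * h ^ ((m + 1) * θ - 1) * Y ^ θ)
        = τ * (h ^ ((m + 1) * θ - 1) * Y ^ θ) := by
          rw [hτ]
          ring
      _ ≤ _ := by gcongr
  have hYle : Y ≤ a + b * A * Y ^ θ := by
    have h1 : τ * Y ≤ τ * (a + b * A * Y ^ θ) := by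
      rw [← hXY]
      refine hle.trans ?_
      nlinarith [mul_le_mul_of_nonneg_left hpow hb]
    exact le_of_mul_le_mul_left h1 hτ0
  have hfin : Y ≤ max 1 ((a + b * A) ^ 3) := by
    rcases le_total Y 1 with hY1 | hY1
    · exact hY1.trans (le_max_left _ _)
    · refine le_trans ?_ (le_max_right _ _)
      -- `Y^θ ≤ t²` for `t = Y^{1/3}`, so that `t³ = Y ≤ (a + b A) t²`
      set t : ℝ := Y ^ (1 / 3 : ℝ) with ht
      have ht1 : 1 ≤ t := Real.one_le_rpow hY1 (by norm_num)
      have ht3 : Y = t ^ 3 := by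
        rw [ht, ← Real.rpow_natCast, ← Real.rpow_mul hY0]
        norm_num
      have ht2 : Y ^ θ ≤ t ^ 2 := by
        have : t ^ 2 = Y ^ (2 / 3 : ℝ) := by
          rw [ht, ← Real.rpow_natCast, ← Real.rpow_mul hY0]
          norm_num
        rw [this]
        exact Real.rpow_le_rpow_of_exponent_le hY1 hθ1
      have h4 : t * t ^ 2 ≤ (a + b * A) * t ^ 2 := by
        have e1 : b * A * Y ^ θ ≤ b * A * t ^ 2 :=
          mul_le_mul_of_nonneg_left ht2 (by positivity)
        have e2 : a ≤ a * t ^ 2 := le_mul_of_one_le_right ha (one_le_pow₀ ht1)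
        have e3 : t * t ^ 2 = Y := by
          rw [ht3]
          ring
        rw [e3]
        linarith
      have h5 : t ≤ a + b * A := le_of_mul_le_mul_right h4 (by positivity)
      rw [ht3]
      exact pow_le_pow_left₀ (by linarith) h5 3
  rw [hXY, mul_comm τ]
  exact mul_le_mul_of_nonneg_right hfin hτ0.le

end MeshWidth

/-! ### The error in `W^{1,q}` -/

section ErrorBounds

variable {d n m : ℕ} {Ω : Set (E d)} {φ : W12 Ω n} {h h₀ : ℝ} {G : Set (Set (E d))}

theorem enorm_sub_le_of_approximation (hΩ : IsOpen Ω) (hh : 0 < h) (hh₀ : h ≤ h₀) {k : ℕ}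
    {v vI : W12 Ω n} {c s : ℝ≥0∞}
    (happ : eLpNorm (toFun (v - vI)) 2 (volume.restrict Ω) +
      ENNReal.ofReal h * sobolevSeminorm Ω 1 2 (toFun (v - vI)) ≤
        c * ENNReal.ofReal (h ^ (k + 1)) * s) :
    ‖v - vI‖ₑ ≤ (ENNReal.ofReal h₀ + d) * (c * s) * ENNReal.ofReal (h ^ k) := by
  have hh' : ENNReal.ofReal h ≠ 0 := by simpa using hh
  have e : c * ENNReal.ofReal (h ^ (k + 1)) * s =
      ENNReal.ofReal h * (c * s * ENNReal.ofReal (h ^ k)) := by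
    rw [pow_succ, ENNReal.ofReal_mul (by positivity)]
    ring
  rw [e] at happ
  have h1 := (le_add_right le_rfl).trans happ
  have h2 : sobolevSeminorm Ω 1 2 (toFun (v - vI)) ≤ c * s * ENNReal.ofReal (h ^ k) :=
    (ENNReal.mul_le_mul_iff_right hh' ENNReal.ofReal_ne_top).1
      ((le_add_left le_rfl).trans happ)
  refine (enorm_le_eLpNorm_add_gradNorm (v - vI)).trans ?_
  calc _ ≤ ENNReal.ofReal h₀ * (c * s * ENNReal.ofReal (h ^ k)) +
        d * (c * s * ENNReal.ofReal (h ^ k)) := by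
        refine add_le_add (h1.trans (mul_le_mul_left (ENNReal.ofReal_le_ofReal hh₀) _)) ?_
        exact (gradNorm_le_sobolevSeminorm hΩ 2 _).trans (mul_le_mul_right h2 _)
    _ = _ := by ring

/-- The approximation of order `m + 1`, which is moreover stable in `W^{1,q}`: the conditions
`d < 2 (m + 1)` and `q ≤ 2 d` if `d = 2 m + 1` say that `q` is admissible. -/
theorem exists_approximation (hΩ : IsOpen Ω) (hdm : d < 2 * (m + 1)) {q : ℝ≥0∞} (hq1 : 1 ≤ q)
    (hq : d = 2 * m + 1 → q ≤ 2 * d) (hh : 0 < h) (hh₀ : h ≤ h₀) {S : Set (W12 Ω n)}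
    {Ca : ℕ → ℝ → ℝ≥0} {Cs : ℕ → ℝ → ℕ → ℝ≥0∞ → ℝ≥0}
    (happ : ApproximationCondition G h m φ S Ca Cs) {u : W12 Ω n} (hu : u ∈ WBdry φ)
    (hus : sobolevNorm Ω (m + 1) 2 (toFun u) ≠ ⊤) :
    ∃ uI ∈ S, gridSeminorm Ω G 1 q (toFun uI) ≤
        Cs (m + 1) 2 1 q * sobolevSeminorm Ω 1 q (toFun u) ∧
      ‖u - uI‖ₑ ≤ (ENNReal.ofReal h₀ + d) *
        (Ca (m + 1) 2 * sobolevSeminorm Ω (m + 1) 2 (toFun u)) * ENNReal.ofReal (h ^ m) := by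
  have h2 : ENNReal.ofReal (2 : ℝ) = 2 := ENNReal.ofReal_ofNat 2
  obtain ⟨uI, huI, hst, hap⟩ := happ (m + 1) 2 (by omega) le_rfl one_le_two
    (Or.inl (by rw [mul_comm]; exact_mod_cast hdm)) u hu (by rwa [h2])
  rw [h2] at hap
  refine ⟨uI, huI, hst 1 q le_rfl (by omega) (Or.inl rfl) hq1 fun hlt => ?_,
    enorm_sub_le_of_approximation hΩ hh hh₀ hap⟩
  have hd : d = 2 * m + 1 := by
    have : 2 * m < d := by
      push_cast at hlt
      have h3 : (2 : ℝ) * m < d := by linarith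
      exact_mod_cast h3
    omega
  refine (hq hd).trans_eq ?_
  have hd' : (d : ℝ) = 2 * m + 1 := by exact_mod_cast hd
  have e : (2 : ℝ) * d / (d - 2 * (((m + 1 : ℕ) : ℝ) - ((1 : ℕ) : ℝ))) = ((2 * d : ℕ) : ℝ) := by
    push_cast
    rw [show (d : ℝ) - 2 * ((m : ℝ) + 1 - 1) = 1 by rw [hd']; ring, div_one]
  rw [e, ENNReal.ofReal_natCast]
  push_cast
  rfl

theorem exists_approximation_two (hΩ : IsOpen Ω) (hm : 1 ≤ m) (hh : 0 < h) (hh₀ : h ≤ h₀)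
    {S : Set (W12 Ω n)} {Ca : ℕ → ℝ → ℝ≥0} {Cs : ℕ → ℝ → ℕ → ℝ≥0∞ → ℝ≥0}
    (happ : ApproximationCondition G h m φ S Ca Cs) {w : W12 Ω n} (hw : w ∈ WBdry φ)
    (hws : sobolevNorm Ω 2 2 (toFun w) ≠ ⊤) :
    ∃ wI ∈ S, ‖w - wI‖ₑ ≤ (ENNReal.ofReal h₀ + d) *
        (Ca 2 2 * sobolevSeminorm Ω 2 2 (toFun w)) * ENNReal.ofReal h := by
  have h2 : ENNReal.ofReal (2 : ℝ) = 2 := ENNReal.ofReal_ofNat 2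
  obtain ⟨wI, hwI, -, hap⟩ := happ 2 2 one_le_two (by omega) one_le_two (Or.inr ⟨rfl, rfl⟩)
    w hw (by rwa [h2])
  rw [h2] at hap
  have := enorm_sub_le_of_approximation (k := 1) hΩ hh hh₀ hap
  rw [pow_one] at this
  exact ⟨wI, hwI, this⟩

/-- The inverse estimate turns the order `m` of the discrete error in `W^{1,2}` into a bound in
`W^{1,q}` that does not depend on `h`. -/
theorem gradNorm_discrete_le (hΩ : IsOpen Ω) (hd : 1 ≤ d) (hdm : d < 2 * (m + 1)) {q : ℝ≥0∞}
    (hq2 : 2 < q) (hq : d = 2 * m + 1 → q ≤ 2 * d) (hh : 0 < h) (hh₀ : h ≤ h₀)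
    {S₀ : Submodule ℝ (W12 Ω n)} {Ci : ℝ≥0∞ → ℝ≥0∞ → ℝ≥0} (hinv : InverseEstimate h S₀ Ci)
    {v : W12 Ω n} (hv : v ∈ S₀) {b : ℝ≥0∞} (hb : ‖v‖ₑ ≤ b * ENNReal.ofReal (h ^ m)) :
    gradNorm q v ≤ d * (Ci q 2 * ENNReal.ofReal (max 1 h₀ ^ m) * ((1 + d) * b)) := by
  have hq1 : 1 ≤ q := one_le_two.trans hq2.le
  have h1 : sobolevNorm Ω 1 2 (toFun v) ≤ (1 + d) * (b * ENNReal.ofReal (h ^ m)) := by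
    refine (sobolevNorm_one_le hd one_le_two v).trans ?_
    calc _ ≤ ‖v‖ₑ + d * ‖v‖ₑ := by
          refine add_le_add ?_ (gradNorm_two_le v)
          rw [← enorm_toL2, enorm_le_iff_norm_le]
          exact norm_toL2_le v
      _ = (1 + d) * ‖v‖ₑ := by ring
      _ ≤ _ := by gcongr
  set x : ℝ := (d : ℝ) * max 0 ((2 : ℝ≥0∞).toReal⁻¹ - q.toReal⁻¹) with hx
  have hxm : x ≤ m := inverse_exponent_le hd hdm hq2 hq
  have hx0 : 0 ≤ x := by positivity
  have hpow : ENNReal.ofReal (h ^ (-x)) * ENNReal.ofReal (h ^ m) ≤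
      ENNReal.ofReal (max 1 h₀ ^ m) := by
    rw [← ENNReal.ofReal_mul (by positivity), ← Real.rpow_natCast h m, ← Real.rpow_add hh]
    exact ENNReal.ofReal_le_ofReal (rpow_le_max_pow hh hh₀ (by linarith) (by linarith))
  have h2 := hinv v hv q 2 hq1 one_le_two
  rw [← hx] at h2
  refine (gradNorm_le_sobolevSeminorm hΩ q v).trans (mul_le_mul_right ?_ _)
  refine ((sobolevSeminorm_le_sobolevNorm 1 q _).trans h2).trans ?_
  calc _ ≤ Ci q 2 * ENNReal.ofReal (h ^ (-x)) * ((1 + d) * (b * ENNReal.ofReal (h ^ m))) := by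
        gcongr
    _ = Ci q 2 * (ENNReal.ofReal (h ^ (-x)) * ENNReal.ofReal (h ^ m)) * ((1 + d) * b) := by ring
    _ ≤ _ := by gcongr

theorem sobolevNorm_add_smul_le (hd : 1 ≤ d) {q : ℝ≥0∞} (hq1 : 1 ≤ q) (u e : W12 Ω n) {s : ℝ}
    (hs : s ∈ Icc (0 : ℝ) 1) :
    sobolevNorm Ω 1 q (toFun (u + s • e)) ≤ (eLpNorm (toFun u) q (volume.restrict Ω) +
      gradNorm q u) + (eLpNorm (toFun e) q (volume.restrict Ω) + gradNorm q e) := by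
  have hs1 : ‖s‖ₑ ≤ 1 := by
    rw [← ofReal_norm, Real.norm_of_nonneg hs.1]
    exact ENNReal.ofReal_le_one.2 hs.2
  have h1 : eLpNorm (toFun (u + s • e)) q (volume.restrict Ω) ≤
      eLpNorm (toFun u) q (volume.restrict Ω) + eLpNorm (toFun e) q (volume.restrict Ω) := by
    have hae : toFun (u + s • e) =ᵐ[volume.restrict Ω] toFun u + s • toFun e :=
      (Lp.coeFn_add (toL2 u) (s • toL2 e)).trans
        (Filter.EventuallyEq.rfl.add (Lp.coeFn_smul s (toL2 e)))
    rw [eLpNorm_congr_ae hae]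
    refine (eLpNorm_add_le (Lp.aestronglyMeasurable (toL2 u))
      ((Lp.aestronglyMeasurable (toL2 e)).const_smul s) hq1).trans (add_le_add_right ?_ _)
    rw [eLpNorm_const_smul]
    exact mul_le_of_le_one_left zero_le hs1
  have h2 : gradNorm q (u + s • e) ≤ gradNorm q u + gradNorm q e := by
    refine (gradNorm_add_le hq1 u (s • e)).trans (add_le_add_right ?_ _)
    rw [gradNorm_smul]
    exact mul_le_of_le_one_left zero_le hs1
  refine (sobolevNorm_one_le hd hq1 _).trans ((add_le_add h1 h2).trans_eq ?_)
  ring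

/-- The gradient of the error in `L^q`, by comparison with the approximation of order `m + 1`. -/
theorem gradNorm_error_le (hΩ : IsOpen Ω) (hd : 1 ≤ d) (hdm : d < 2 * (m + 1)) {q : ℝ≥0∞}
    (hq2 : 2 < q) (hq : d = 2 * m + 1 → q ≤ 2 * d) (hh : 0 < h) (hh₀ : h ≤ h₀) {c C : ℝ}
    {T : Set (E d)} (hG : IsGrid Ω h m c C T G) {A : AffineSubspace ℝ (W12 Ω n)}
    {Ca : ℕ → ℝ → ℝ≥0} {Cs : ℕ → ℝ → ℕ → ℝ≥0∞ → ℝ≥0} {Ci : ℝ≥0∞ → ℝ≥0∞ → ℝ≥0}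
    (happ : ApproximationCondition G h m φ (A : Set (W12 Ω n)) Ca Cs)
    (hinv : InverseEstimate h A.direction Ci) {u uh : W12 Ω n} (hu : u ∈ WBdry φ)
    (hus : sobolevNorm Ω (m + 1) 2 (toFun u) ≠ ⊤) (huh : uh ∈ A) {b M₁ M₂ : ℝ≥0∞}
    (herr : ‖u - uh‖ₑ ≤ b * ENNReal.ofReal (h ^ m)) (hM₁ : sobolevNorm Ω 1 q (toFun u) ≤ M₁)
    (hM₂ : sobolevSeminorm Ω (m + 1) 2 (toFun u) ≤ M₂) :
    gradNorm q (uh - u) ≤ d * (Ci q 2 * ENNReal.ofReal (max 1 h₀ ^ m) *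
      ((1 + d) * ((ENNReal.ofReal h₀ + d) * (Ca (m + 1) 2 * M₂) + b))) +
      (d * (Cs (m + 1) 2 1 q * M₁) + d * M₁) := by
  have hq1 : 1 ≤ q := one_le_two.trans hq2.le
  obtain ⟨uI, huI, hst, hap⟩ := exists_approximation hΩ hdm hq1 hq hh hh₀ happ hu hus
  have hu1 : sobolevSeminorm Ω 1 q (toFun u) ≤ M₁ :=
    (sobolevSeminorm_le_sobolevNorm 1 q _).trans hM₁
  have hdisc : ‖uh - uI‖ₑ ≤ ((ENNReal.ofReal h₀ + d) * (Ca (m + 1) 2 * M₂) + b) *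
      ENNReal.ofReal (h ^ m) := by
    rw [show uh - uI = (u - uI) - (u - uh) by abel, add_mul]
    refine (enorm_sub_le (E := W12 Ω n)).trans (add_le_add (hap.trans ?_) herr)
    gcongr
  have hg1 := gradNorm_discrete_le hΩ hd hdm hq2 hq hh hh₀ hinv
    (AffineSubspace.vsub_mem_direction huh huI) hdisc
  have hg2 : gradNorm q uI ≤ d * (Cs (m + 1) 2 1 q * M₁) :=
    (gradNorm_le_gridSeminorm hΩ hG.finite hG.isOpen hG.subset hG.cover q uI).trans
      (mul_le_mul_right (hst.trans (mul_le_mul_right hu1 _)) _)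
  have hg3 : gradNorm q u ≤ d * M₁ :=
    (gradNorm_le_sobolevSeminorm hΩ q u).trans (mul_le_mul_right hu1 _)
  rw [show uh - u = (uh - uI) + (uI - u) by abel]
  exact (gradNorm_add_le hq1 _ _).trans
    (add_le_add hg1 ((gradNorm_sub_le hq1 _ _).trans (add_le_add hg2 hg3)))

set_option maxHeartbeats 800000 in
/-- The discrete solutions are bounded in `W^{1,q}`, and the errors in `L^∞`, uniformly in `h`. -/
theorem exists_uniform_bounds (hd : 1 ≤ d) (hdm : d < 2 * (m + 1)) {q : ℝ≥0∞}
    (hq2 : 2 < q) (hqd : (d : ℝ≥0∞) < q) (hq : d = 2 * m + 1 → q ≤ 2 * d) (hΩ : IsOpen Ω)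
    (hΩb : Bornology.IsBounded Ω) (h₀ : ℝ) (Ca : ℕ → ℝ → ℝ≥0) (Cs : ℕ → ℝ → ℕ → ℝ≥0∞ → ℝ≥0)
    (Ci : ℝ≥0∞ → ℝ≥0∞ → ℝ≥0) (C₁ M₁ M₂ : ℝ≥0) :
    ∃ R B : ℝ≥0, ∀ (φ : W12 Ω n), ∀ u ∈ WBdry φ, sobolevNorm Ω (m + 1) 2 (toFun u) ≠ ⊤ →
      ∀ h : ℝ, 0 < h → h ≤ h₀ → ∀ (c C : ℝ) (T : Set (E d)) (G : Set (Set (E d))),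
      IsGrid Ω h m c C T G → ∀ A : AffineSubspace ℝ (W12 Ω n), IsDiscreteSpace φ A →
      ApproximationCondition G h m φ (A : Set (W12 Ω n)) Ca Cs →
      InverseEstimate h A.direction Ci → ∀ uh ∈ A,
      ‖u - uh‖ₑ ≤ C₁ * M₂ * ENNReal.ofReal (h ^ m) →
      sobolevNorm Ω 1 q (toFun u) ≤ M₁ → sobolevSeminorm Ω (m + 1) 2 (toFun u) ≤ M₂ →
      eLpNorm (toFun (uh - u)) ⊤ (volume.restrict Ω) ≤ B ∧
        ∀ s ∈ Icc (0 : ℝ) 1, sobolevNorm Ω 1 q (toFun (u + s • (uh - u))) ≤ R := by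
  have hq1 : 1 ≤ q := one_le_two.trans hq2.le
  obtain ⟨Cm, hCm⟩ := exists_eLpNorm_top_le_gradNorm (n := n) hd hΩ hΩb hqd
  obtain ⟨D, hD⟩ : ∃ D : ℝ≥0, (D : ℝ≥0∞) = d * (Ci q 2 * ENNReal.ofReal (max 1 h₀ ^ m) *
      ((1 + d) * ((ENNReal.ofReal h₀ + d) * (Ca (m + 1) 2 * M₂) + C₁ * M₂))) +
      (d * (Cs (m + 1) 2 1 q * M₁) + d * M₁) :=
    ⟨_, ENNReal.coe_toNNReal (by finiteness)⟩
  have hVt : volume Ω ≠ ⊤ := hΩb.measure_lt_top.ne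
  obtain ⟨R, hR⟩ : ∃ R : ℝ≥0, (R : ℝ≥0∞) =
      (M₁ + d * M₁) + ((1 + volume Ω) * (Cm * D) + D) :=
    ⟨_, ENNReal.coe_toNNReal (by finiteness)⟩
  refine ⟨R, Cm * D, ?_⟩
  intro φ u hu hus h hh hh₀ c C T G hG A hA happ hinv uh huh herr hM₁ hM₂
  rw [hR, ENNReal.coe_mul]
  have hgrad : gradNorm q (uh - u) ≤ D := by
    rw [hD]
    exact gradNorm_error_le hΩ hd hdm hq2 hq hh hh₀ hG happ hinv hu hus huh herr hM₁ hM₂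
  have hg3 : gradNorm q u ≤ d * M₁ := (gradNorm_le_sobolevSeminorm hΩ q u).trans
    (mul_le_mul_right ((sobolevSeminorm_le_sobolevNorm 1 q _).trans hM₁) _)
  have htop : eLpNorm (toFun (uh - u)) ⊤ (volume.restrict Ω) ≤ Cm * D :=
    (hCm _ (sub_mem_W012 (hA.subset huh) hu)).trans (mul_le_mul_right hgrad _)
  refine ⟨htop, fun s hs => (sobolevNorm_add_smul_le hd hq1 u (uh - u) hs).trans ?_⟩
  refine add_le_add (add_le_add ((eLpNorm_le_sobolevNorm_one hΩ q _).trans hM₁) hg3)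
    (add_le_add ?_ hgrad)
  exact (eLpNorm_le_eLpNorm_of_exponent_le hq1 le_top (Lp.aestronglyMeasurable _)).trans
    (mul_le_mul_right htop _)

end ErrorBounds

/-! ### The error in `L²` -/

section FinalEstimate

variable {d n m : ℕ} {Ω : Set (E d)}

theorem toReal_one_add_mul {c V : ℝ≥0∞} (hV : V ≠ ⊤) :
    ((1 + V) * c).toReal = (1 + V.toReal) * c.toReal := by
  rw [ENNReal.toReal_mul, ENNReal.toReal_add ENNReal.one_ne_top hV, ENNReal.toReal_one]

/-- The `L^r` norm of a bounded function for `1 ≤ r ≤ d`, in terms of its `L²` norm, with constants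
that do not depend on `r`: this is Hölder's inequality for `d ≤ 2`, and it follows by interpolation
between `L²` and `L^∞` for `d ≥ 3`. -/
theorem toReal_eLpNorm_le (hΩb : Bornology.IsBounded Ω) {r : ℝ} (hr1 : 1 ≤ r) (hrd : r ≤ d)
    (e : W12 Ω n) {B : ℝ≥0} (hB : eLpNorm (toFun e) ⊤ (volume.restrict Ω) ≤ B) :
    (eLpNorm (toFun e) (ENNReal.ofReal r) (volume.restrict Ω)).toReal ≤
        (1 + (volume Ω).toReal) * ‖toL2 e‖ ∨
      3 ≤ d ∧ (eLpNorm (toFun e) (ENNReal.ofReal r) (volume.restrict Ω)).toReal ≤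
        (1 + (volume Ω).toReal) * ((1 + B) * ‖toL2 e‖ ^ (2 / d : ℝ)) := by
  have hVt : volume Ω ≠ ⊤ := hΩb.measure_lt_top.ne
  have hr : 1 ≤ ENNReal.ofReal r := by simpa using hr1
  have hX : eLpNorm (toFun e) 2 (volume.restrict Ω) = ‖toL2 e‖ₑ := (enorm_toL2 e).symm
  by_cases hd : d ≤ 2
  · left
    have hr2 : ENNReal.ofReal r ≤ 2 := by
      have hd' : (d : ℝ) ≤ 2 := by exact_mod_cast hd
      exact (ENNReal.ofReal_le_ofReal (hrd.trans hd')).trans_eq (ENNReal.ofReal_ofNat 2)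
    have h1 := eLpNorm_le_eLpNorm_of_exponent_le hr hr2 (Lp.aestronglyMeasurable (toL2 e))
    change eLpNorm (toFun e) _ _ ≤ _ * eLpNorm (toFun e) _ _ at h1
    rw [hX] at h1
    refine (ENNReal.toReal_mono (by finiteness) h1).trans_eq ?_
    rw [toReal_one_add_mul hVt, toReal_enorm]
  · right
    refine ⟨by omega, ?_⟩
    have hd3 : (3 : ℝ) ≤ d := by exact_mod_cast (by omega : 3 ≤ d)
    have hBt := ne_top_of_le_ne_top ENNReal.coe_ne_top hB
    have h1 := eLpNorm_le_eLpNorm_of_exponent_le hr (ENNReal.ofReal_le_ofReal hrd)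
      (Lp.aestronglyMeasurable (toL2 e))
    change eLpNorm (toFun e) _ _ ≤ _ * eLpNorm (toFun e) _ _ at h1
    have h2 := eLpNorm_le_interpolate (r := d) (by linarith) hBt
    rw [hX] at h2
    have hθ : 2 / (d : ℝ) ≤ 1 := by
      rw [div_le_one (by linarith)]
      linarith
    have h3 : eLpNorm (toFun e) ⊤ (volume.restrict Ω) ^ (1 - 2 / (d : ℝ)) ≤ 1 + B :=
      (ENNReal.rpow_le_rpow hB (by linarith)).trans
        (rpow_le_one_add _ (by linarith) (by linarith [show 0 ≤ 2 / (d : ℝ) by positivity]))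
    have hXt : ‖toL2 e‖ₑ ^ (2 / d : ℝ) ≠ ⊤ :=
      ENNReal.rpow_ne_top_of_nonneg (by positivity) enorm_ne_top
    have h4 := h1.trans (mul_le_mul_right (h2.trans (mul_le_mul_left h3 _)) _)
    refine (ENNReal.toReal_mono (by finiteness) h4).trans_eq ?_
    rw [toReal_one_add_mul hVt, ENNReal.toReal_mul, ← ENNReal.toReal_rpow,
      toReal_enorm, ENNReal.toReal_add ENNReal.one_ne_top ENNReal.coe_ne_top]
    rfl

/-- The final step: after division by the `L²` norm `X` of the error, the estimate
`X² ≤ (a h^{m+1} + b h^m N) X` gives the order `m + 1`, both if `N` is at most of the order `h` and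
if it is at most of the order `X^{2/d}`. -/
theorem le_of_sq_le (hm : 1 ≤ m) (hdm : d < 2 * (m + 1)) {h h₀ : ℝ} (hh : 0 < h) (hh₀ : h ≤ h₀)
    {a b c c' X N : ℝ} (ha : 0 ≤ a) (hb : 0 ≤ b) (hc : 0 ≤ c) (hc' : 0 ≤ c') (hX : 0 ≤ X)
    (hsq : X ^ 2 ≤ (a * h ^ (m + 1) + b * h ^ m * N) * X)
    (hN : N ≤ c * h ^ m ∨ 3 ≤ d ∧ N ≤ c' * X ^ (2 / d : ℝ)) :
    X ≤ ((a + b * (c * max 1 h₀ ^ m)) + max 1 ((a + b * c' * max 1 h₀ ^ m) ^ 3)) *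
      h ^ (m + 1) := by
  have hA : 0 < max 1 h₀ ^ m := pow_pos (lt_max_of_lt_left one_pos) m
  have hp : 0 < h ^ (m + 1) := by positivity
  have hX1 : X ≤ a * h ^ (m + 1) + b * h ^ m * N ∨ X = 0 := by
    rcases hX.eq_or_lt with h0 | h0
    · exact Or.inr h0.symm
    · left
      rw [pow_two] at hsq
      exact le_of_mul_le_mul_right hsq h0
  rcases hX1 with hX1 | hX1
  swap
  · rw [hX1]
    positivity
  rw [add_mul]
  rcases hN with hN | ⟨hd, hN⟩
  · have h1 : N ≤ c * (max 1 h₀ ^ m * h) :=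
      hN.trans (mul_le_mul_of_nonneg_left (pow_le_mul_of_one_le hh hh₀ hm) hc)
    have h2 : b * h ^ m * N ≤ b * h ^ m * (c * (max 1 h₀ ^ m * h)) :=
      mul_le_mul_of_nonneg_left h1 (by positivity)
    have h3 : b * h ^ m * (c * (max 1 h₀ ^ m * h)) = b * (c * max 1 h₀ ^ m) * h ^ (m + 1) := by
      ring
    have h4 : 0 ≤ max 1 ((a + b * c' * max 1 h₀ ^ m) ^ 3) * h ^ (m + 1) := by positivity
    rw [add_mul]
    linarith
  · have h2 : b * h ^ m * N ≤ b * c' * (h ^ m * X ^ (2 / d : ℝ)) := by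
      calc b * h ^ m * N ≤ b * h ^ m * (c' * X ^ (2 / d : ℝ)) :=
            mul_le_mul_of_nonneg_left hN (by positivity)
        _ = _ := by ring
    have h3 := le_of_le_add_rpow hd hdm hh hh₀ ha (mul_nonneg hb hc') hX
      (hX1.trans (add_le_add_right h2 _))
    have h4 : 0 ≤ (a + b * (c * max 1 h₀ ^ m)) * h ^ (m + 1) := by positivity
    linarith

theorem norm_toL2_sub_rev (u v : W12 Ω n) : ‖toL2 (u - v)‖ = ‖toL2 (v - u)‖ :=
  norm_sub_rev (toL2 u) (toL2 v)

end FinalEstimate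

section Combination

variable {d n m : ℕ} {Ω : Set (E d)}

theorem ThirdVariationBound.abs_le_norm {J : W12 Ω n → ℝ} {H : Set (W12 Ω n)} {q : ℝ≥0∞}
    {K : ℝ≥0 → ℝ≥0} (h : ThirdVariationBound J H q K (fun V => ‖V‖ₑ)) {R : ℝ≥0} {v : W12 Ω n}
    (hv : v ∈ H) (hR : sobolevNorm Ω 1 q (toFun v) ≤ R) {U V : W012 Ω n}
    (hU : sobolevNorm Ω 2 2 (toFun (U : W12 Ω n)) ≠ ⊤) :
    |variation3 J v U V V| ≤ K R * (sobolevNorm Ω 2 2 (toFun (U : W12 Ω n))).toReal *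
      ‖(V : W12 Ω n)‖ * ‖(V : W12 Ω n)‖ :=
  (h.abs_le hv hR hU (enorm_W012_ne_top V)).trans_eq
    (congrArg (K R * (sobolevNorm Ω 2 2 (toFun (U : W12 Ω n))).toReal * ‖(V : W12 Ω n)‖ * ·)
      (toReal_enorm_W012 V))

/-- The bound of the third variation in direction of the error `e`, in a form that covers both
alternatives of `IsPredominantlyQuadratic`. -/
theorem exists_variation3_bound (hΩb : Bornology.IsBounded Ω) {H : Set (W12 Ω n)}
    {J : W12 Ω n → ℝ} {q : ℝ≥0∞} {K : ℝ≥0 → ℝ≥0} (hJ : IsPredominantlyQuadratic J H q K)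
    {u : W12 Ω n} {e W : W012 Ω n} {R B : ℝ≥0}
    (hR : ∀ s ∈ Icc (0 : ℝ) 1, sobolevNorm Ω 1 q (toFun (u + s • (e : W12 Ω n))) ≤ R)
    (hB : eLpNorm (toFun (e : W12 Ω n)) ⊤ (volume.restrict Ω) ≤ B)
    (hW : sobolevNorm Ω 2 2 (toFun (W : W12 Ω n)) ≠ ⊤) :
    ∃ N : ℝ, 0 ≤ N ∧ (N ≤ (1 + (volume Ω).toReal) * ‖(e : W12 Ω n)‖ ∨
        3 ≤ d ∧ N ≤ (1 + (volume Ω).toReal) *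
          ((1 + B) * ‖toL2 (e : W12 Ω n)‖ ^ (2 / d : ℝ))) ∧
      ∀ s ∈ Icc (0 : ℝ) 1, u + s • (e : W12 Ω n) ∈ H →
        |variation3 J (u + s • (e : W12 Ω n)) W e e| ≤
          K R * (sobolevNorm Ω 2 2 (toFun (W : W12 Ω n))).toReal * ‖(e : W12 Ω n)‖ * N := by
  have hV : 0 ≤ (volume Ω).toReal := ENNReal.toReal_nonneg
  refine hJ.2.elim (fun h => ?_) fun ⟨r, hr1, hrd, h⟩ => ?_
  · exact ⟨‖(e : W12 Ω n)‖, norm_nonneg _,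
      Or.inl (le_mul_of_one_le_left (norm_nonneg _) (le_add_of_nonneg_right hV)),
      fun s hs hsH => h.abs_le_norm hsH (hR s hs) hW⟩
  · have hr : 1 ≤ ENNReal.ofReal r := by simpa using hr1
    have hVt : 1 + volume Ω ≠ ⊤ := by simpa using hΩb.measure_lt_top.ne
    have hfin : eLpNorm (toFun (e : W12 Ω n)) (ENNReal.ofReal r) (volume.restrict Ω) ≠ ⊤ :=
      ne_top_of_le_ne_top
        (ENNReal.mul_ne_top hVt (ne_top_of_le_ne_top ENNReal.coe_ne_top hB))
        (eLpNorm_le_eLpNorm_of_exponent_le hr le_top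
          (Lp.aestronglyMeasurable (toL2 (e : W12 Ω n))))
    exact ⟨_, ENNReal.toReal_nonneg,
      (toReal_eLpNorm_le hΩb hr1 hrd (e : W12 Ω n) hB).imp_left fun h1 => h1.trans
        (mul_le_mul_of_nonneg_left (norm_toL2_le _) (add_nonneg zero_le_one hV)),
      fun s hs hsH => h.abs_le hsH (hR s hs) hW hfin⟩

theorem mem_W012_of_mem_direction {φ : W12 Ω n} {A : AffineSubspace ℝ (W12 Ω n)}
    (hA : IsDiscreteSpace φ A) {a w : W12 Ω n} (ha : a ∈ A) (hw : w ∈ A.direction) :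
    w ∈ W012 Ω n := by
  have h1 : w + a ∈ A := AffineSubspace.vadd_mem_of_mem_direction hw ha
  have h2 := sub_mem_W012 (hA.subset h1) (hA.subset ha)
  rwa [add_sub_cancel_right] at h2

theorem coe_mem_WBdry_zero (W : W012 Ω n) : (W : W12 Ω n) ∈ WBdry (0 : W12 Ω n) := by
  change (W : W12 Ω n) - 0 ∈ W012 Ω n
  rw [sub_zero]
  exact W.2

set_option maxHeartbeats 1000000 in
/-- The discrete approximation of the solution of the adjoint problem. -/
theorem exists_adjoint_approximation (hm : 1 ≤ m) (hΩ : IsOpen Ω) {h h₀ : ℝ} (hh : 0 < h)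
    (hh₀ : h ≤ h₀) {G : Set (Set (E d))} {Ca : ℕ → ℝ → ℝ≥0} {Cs : ℕ → ℝ → ℕ → ℝ≥0∞ → ℝ≥0}
    {φ : W12 Ω n} {A : AffineSubspace ℝ (W12 Ω n)} (hA : IsDiscreteSpace φ A)
    (happ : ApproximationCondition G h m 0 (A.direction : Set (W12 Ω n)) Ca Cs) {a : W12 Ω n}
    (ha : a ∈ A) {W : W012 Ω n} {Cr : ℝ≥0} {f : Lp (E n) 2 (volume.restrict Ω)}
    (hW : sobolevNorm Ω 2 2 (toFun (W : W12 Ω n)) ≤ Cr * ‖f‖ₑ) :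
    ∃ WI : W012 Ω n, (WI : W12 Ω n) ∈ A.direction ∧ ‖(W : W12 Ω n) - WI‖ ≤
      ((ENNReal.ofReal h₀ + d) * (Ca 2 2 * Cr)).toReal * ‖f‖ * h := by
  have hWt : sobolevNorm Ω 2 2 (toFun (W : W12 Ω n)) ≠ ⊤ :=
    ne_top_of_le_ne_top (ENNReal.mul_ne_top ENNReal.coe_ne_top enorm_ne_top) hW
  obtain ⟨WI, hWI, hWW⟩ := exists_approximation_two hΩ hm hh hh₀ happ (coe_mem_WBdry_zero W) hWt
  refine ⟨⟨WI, mem_W012_of_mem_direction hA ha hWI⟩, hWI, ?_⟩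
  have h1 : ‖(W : W12 Ω n) - WI‖ₑ ≤
      (ENNReal.ofReal h₀ + d) * (Ca 2 2 * Cr) * ‖f‖ₑ * ENNReal.ofReal h := by
    refine hWW.trans (mul_le_mul_left ?_ _)
    rw [mul_assoc, mul_assoc]
    exact mul_le_mul_right (mul_le_mul_right ((sobolevSeminorm_le_sobolevNorm 2 2 _).trans hW) _) _
  have h2 := ENNReal.toReal_mono (by finiteness) h1
  rw [ENNReal.toReal_mul, ENNReal.toReal_mul, ENNReal.toReal_ofReal hh.le, toReal_enorm,
    toReal_enorm] at h2
  exact h2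

/-- Insertion of the bounds of the error, of the adjoint solution and of its approximation into the
duality estimate. -/
theorem sq_le_of_duality {h X N ε w S a b cw cr C₀ : ℝ} (hh : 0 < h) (ha : 0 ≤ a) (hb : 0 ≤ b)
    (hX : 0 ≤ X) (hN : 0 ≤ N) (hε : 0 ≤ ε) (hw₀ : 0 ≤ w) (hC₀ : 0 ≤ C₀)
    (hcr : 0 ≤ cr) (hsq : X ^ 2 ≤ a * ε * w + b * S * ε * N) (herr : ε ≤ C₀ * h ^ m)
    (hw : w ≤ cw * X * h) (hS : S ≤ cr * X) :
    X ^ 2 ≤ (a * C₀ * cw * h ^ (m + 1) + b * cr * C₀ * h ^ m * N) * X := by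
  have h1 : a * ε * w ≤ a * (C₀ * h ^ m) * (cw * X * h) := by gcongr
  have h2 : b * S * ε * N ≤ b * (cr * X) * (C₀ * h ^ m) * N := by gcongr
  refine (hsq.trans (add_le_add h1 h2)).trans_eq ?_
  ring

set_option maxHeartbeats 2000000 in
/-- The duality argument: the squared `L²` error is tested with the solution `W` of the adjoint
problem. -/
theorem sq_norm_toL2_error_le (hm : 1 ≤ m) (hΩ : IsOpen Ω)
    (hΩb : Bornology.IsBounded Ω) {q : ℝ≥0∞} {lam Lam : ℝ} (hlam : 0 < lam) (hLam : 0 < Lam)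
    {K : ℝ≥0 → ℝ≥0} {φ : W12 Ω n} {H : Set (W12 Ω n)} (hH : IsAdmissible φ H) {J : W12 Ω n → ℝ}
    (hJ : IsElliptic J H lam Lam) (hJq : IsPredominantlyQuadratic J H q K) {u : W12 Ω n}
    (hu : u ∈ H) (hmin : IsMinOn J H u) {h h₀ : ℝ} (hh : 0 < h) (hh₀ : h ≤ h₀)
    {G : Set (Set (E d))} {Ca : ℕ → ℝ → ℝ≥0} {Cs : ℕ → ℝ → ℕ → ℝ≥0∞ → ℝ≥0}
    {A : AffineSubspace ℝ (W12 Ω n)} (hA : IsDiscreteSpace φ A)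
    (happ : ApproximationCondition G h m 0 (A.direction : Set (W12 Ω n)) Ca Cs) {uh : W12 Ω n}
    (huh : uh ∈ H ∩ (A : Set (W12 Ω n))) (hminh : IsLocalMinOn J (H ∩ (A : Set (W12 Ω n))) uh)
    {Cr : ℝ≥0} (hreg : AdjointH2Regular J u uh Cr) {C₀ R B : ℝ≥0} {e : W012 Ω n}
    (he : u + (e : W12 Ω n) = uh) (herr : ‖(e : W12 Ω n)‖ ≤ C₀ * h ^ m)
    (hB : eLpNorm (toFun (e : W12 Ω n)) ⊤ (volume.restrict Ω) ≤ B)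
    (hR : ∀ s ∈ Icc (0 : ℝ) 1, sobolevNorm Ω 1 q (toFun (u + s • (e : W12 Ω n))) ≤ R) :
    ∃ N : ℝ, (N ≤ (1 + (volume Ω).toReal) * ‖(e : W12 Ω n)‖ ∨ 3 ≤ d ∧
        N ≤ (1 + (volume Ω).toReal) * ((1 + B) * ‖toL2 (e : W12 Ω n)‖ ^ (2 / d : ℝ))) ∧
      ‖toL2 (e : W12 Ω n)‖ ^ 2 ≤
        (Lam * C₀ * ((ENNReal.ofReal h₀ + d) * (Ca 2 2 * Cr)).toReal * h ^ (m + 1) +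
          K R * Cr * C₀ * h ^ m * N) * ‖toL2 (e : W12 Ω n)‖ := by
  have he' : uh - u = e := by rw [← he, add_sub_cancel_left]
  obtain ⟨W, hW⟩ := exists_adjoint_solution hΩb hlam hJ hu (toL2 (e : W12 Ω n))
  have hWr : sobolevNorm Ω 2 2 (toFun (W : W12 Ω n)) ≤ Cr * ‖toL2 (e : W12 Ω n)‖ₑ := by
    have h1 := hreg W (by rwa [he'])
    have h2 : ‖toL2 (u - uh)‖ₑ = ‖toL2 (e : W12 Ω n)‖ₑ := by
      rw [← he']
      exact enorm_sub_rev (toL2 u) (toL2 uh)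
    rwa [h2] at h1
  have hX : (Cr : ℝ≥0∞) * ‖toL2 (e : W12 Ω n)‖ₑ ≠ ⊤ :=
    ENNReal.mul_ne_top ENNReal.coe_ne_top enorm_ne_top
  have hS : (sobolevNorm Ω 2 2 (toFun (W : W12 Ω n))).toReal ≤ Cr * ‖toL2 (e : W12 Ω n)‖ := by
    refine (ENNReal.toReal_mono hX hWr).trans_eq ?_
    rw [ENNReal.toReal_mul, toReal_enorm, ENNReal.coe_toReal]
  obtain ⟨WI, hWI, hWW⟩ := exists_adjoint_approximation hm hΩ hh hh₀ hA happ huh.2 hWr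
  obtain ⟨N, hN₀, hN, hM⟩ := exists_variation3_bound hΩb hJq hR hB (ne_top_of_le_ne_top hX hWr)
  have hdual := neg_variation2_le hH hJ hJq.1 hu hmin huh hminh he hWI hM
  rw [hW, neg_neg, real_inner_self_eq_norm_sq] at hdual
  exact ⟨N, hN, sq_le_of_duality hh hLam.le NNReal.zero_le_coe (norm_nonneg _) hN₀
    (norm_nonneg _) (norm_nonneg _) NNReal.zero_le_coe NNReal.zero_le_coe hdual herr hWW hS⟩

set_option maxHeartbeats 1000000 in
/-- The error estimate, with the bounds of `exists_uniform_bounds` as hypotheses. -/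
theorem norm_toL2_error_le (hm : 1 ≤ m) (hdm : d < 2 * (m + 1)) (hΩ : IsOpen Ω)
    (hΩb : Bornology.IsBounded Ω) {q : ℝ≥0∞} {lam Lam : ℝ} (hlam : 0 < lam) (hLam : 0 < Lam)
    {K : ℝ≥0 → ℝ≥0} {φ : W12 Ω n} {H : Set (W12 Ω n)} (hH : IsAdmissible φ H) {J : W12 Ω n → ℝ}
    (hJ : IsElliptic J H lam Lam) (hJq : IsPredominantlyQuadratic J H q K) {u : W12 Ω n}
    (hu : u ∈ H) (hmin : IsMinOn J H u) {h h₀ : ℝ} (hh : 0 < h) (hh₀ : h ≤ h₀)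
    {G : Set (Set (E d))} {Ca : ℕ → ℝ → ℝ≥0} {Cs : ℕ → ℝ → ℕ → ℝ≥0∞ → ℝ≥0}
    {A : AffineSubspace ℝ (W12 Ω n)} (hA : IsDiscreteSpace φ A)
    (happ : ApproximationCondition G h m 0 (A.direction : Set (W12 Ω n)) Ca Cs) {uh : W12 Ω n}
    (huh : uh ∈ H ∩ (A : Set (W12 Ω n))) (hminh : IsLocalMinOn J (H ∩ (A : Set (W12 Ω n))) uh)
    {Cr : ℝ≥0} (hreg : AdjointH2Regular J u uh Cr) {C₀ R B : ℝ≥0}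
    (herr : ‖u - uh‖ ≤ C₀ * h ^ m)
    (hB : eLpNorm (toFun (uh - u)) ⊤ (volume.restrict Ω) ≤ B)
    (hR : ∀ s ∈ Icc (0 : ℝ) 1, sobolevNorm Ω 1 q (toFun (u + s • (uh - u))) ≤ R) :
    ‖toL2 (u - uh)‖ ≤
      ((Lam * C₀ * ((ENNReal.ofReal h₀ + d) * (Ca 2 2 * Cr)).toReal +
        K R * Cr * C₀ * ((1 + (volume Ω).toReal) * C₀ * max 1 h₀ ^ m)) +
      max 1 ((Lam * C₀ * ((ENNReal.ofReal h₀ + d) * (Ca 2 2 * Cr)).toReal +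
        K R * Cr * C₀ * ((1 + (volume Ω).toReal) * (1 + B)) * max 1 h₀ ^ m) ^ 3)) *
      h ^ (m + 1) := by
  have he : uh - u ∈ W012 Ω n :=
    sub_mem_W012 (hH.subset_WBdry huh.1) (hH.subset_WBdry hu)
  have herr' : ‖uh - u‖ ≤ C₀ * h ^ m := (norm_sub_rev uh u).trans_le herr
  obtain ⟨N, hN, hsq⟩ := sq_norm_toL2_error_le hm hΩ hΩb hlam hLam hH hJ hJq hu hmin hh hh₀ hA
    happ huh hminh hreg (e := ⟨uh - u, he⟩) (add_sub_cancel u uh) herr' hB hR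
  have hV : 0 ≤ 1 + (volume Ω).toReal := add_nonneg zero_le_one ENNReal.toReal_nonneg
  rw [norm_toL2_sub_rev u uh]
  refine le_of_sq_le (N := N) hm hdm hh hh₀ (mul_nonneg (by positivity) ENNReal.toReal_nonneg)
    (by positivity) (mul_nonneg hV NNReal.zero_le_coe) (mul_nonneg hV (by positivity))
    (norm_nonneg _) hsq (hN.imp (fun h1 => h1.trans ?_) fun h1 => ⟨h1.1, h1.2.trans_eq ?_⟩)
  · rw [mul_assoc]
    exact mul_le_mul_of_nonneg_left herr' hV
  · rw [mul_assoc]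

end Combination

end SemilinearFEM

end

open SemilinearFEM in
theorem theoremT
    (d n m : ℕ) (hd : 1 ≤ d) (hm : 1 ≤ m) (hdm : d < 2 * (m + 1))
    (q : ℝ≥0∞) (hq2 : 2 < q) (hqd : (d : ℝ≥0∞) < q) (hq : d = 2 * m + 1 → q ≤ 2 * d)
    (Ω : Set (E d)) (hΩ : IsOpen Ω) (hΩb : Bornology.IsBounded Ω)
    -- constants of the energy
    (lam Lam : ℝ) (hlam : 0 < lam) (hLam : 0 < Lam) (K : ℝ≥0 → ℝ≥0)
    -- constants of the grid and of the discrete space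
    (h₀ : ℝ) (cG CG : ℝ) (hcG : 0 < cG) (Tref : Set (E d))
    (Ca : ℕ → ℝ → ℝ≥0) (Cs : ℕ → ℝ → ℕ → ℝ≥0∞ → ℝ≥0) (Ci : ℝ≥0∞ → ℝ≥0∞ → ℝ≥0)
    -- constants of the a priori bound and of the adjoint regularity
    (C₁ Cr : ℝ≥0) :
    ∃ C : ℝ≥0 → ℝ≥0 → ℝ≥0,
      ∀ (φ : W12 Ω n) (H : Set (W12 Ω n)), IsAdmissible φ H →
      ∀ J : W12 Ω n → ℝ, IsElliptic J H lam Lam → IsPredominantlyQuadratic J H q K →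
      -- the continuous minimizer
      ∀ u ∈ H, IsMinOn J H u → sobolevNorm Ω (m + 1) 2 (toFun u) ≠ ⊤ →
      -- the discretization
      ∀ h : ℝ, 0 < h → h ≤ h₀ →
      ∀ G : Set (Set (E d)), IsGrid Ω h m cG CG Tref G →
      ∀ A : AffineSubspace ℝ (W12 Ω n), IsDiscreteSpace φ A →
        ApproximationCondition G h m φ (A : Set (W12 Ω n)) Ca Cs →
        ApproximationCondition G h m 0 (A.direction : Set (W12 Ω n)) Ca Cs →
        InverseEstimate h A.direction Ci →
      -- the discrete local minimizer, with its a priori bound in `W^{1,2}`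
      ∀ uh ∈ H ∩ (A : Set (W12 Ω n)), IsLocalMinOn J (H ∩ (A : Set (W12 Ω n))) uh →
        ‖u - uh‖ ≤ C₁ * h ^ m * (sobolevSeminorm Ω (m + 1) 2 (toFun u)).toReal →
        AdjointH2Regular J u uh Cr →
      -- the error estimate
      ∀ M₁ M₂ : ℝ≥0, sobolevNorm Ω 1 q (toFun u) ≤ M₁ →
        sobolevSeminorm Ω (m + 1) 2 (toFun u) ≤ M₂ →
        ‖toL2 (u - uh)‖ ≤ C M₁ M₂ * h ^ (m + 1) := by
  choose R B hRB using fun M₁ M₂ : ℝ≥0 => exists_uniform_bounds (n := n) hd hdm hq2 hqd hq hΩ hΩb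
    h₀ Ca Cs Ci C₁ M₁ M₂
  refine ⟨fun M₁ M₂ => Real.toNNReal
    ((Lam * ↑(C₁ * M₂) * ((ENNReal.ofReal h₀ + d) * (Ca 2 2 * Cr)).toReal +
        K (R M₁ M₂) * Cr * ↑(C₁ * M₂) *
          ((1 + (volume Ω).toReal) * ↑(C₁ * M₂) * max 1 h₀ ^ m)) +
      max 1 ((Lam * ↑(C₁ * M₂) * ((ENNReal.ofReal h₀ + d) * (Ca 2 2 * Cr)).toReal +
        K (R M₁ M₂) * Cr * ↑(C₁ * M₂) *
          ((1 + (volume Ω).toReal) * (1 + B M₁ M₂)) * max 1 h₀ ^ m) ^ 3)), ?_⟩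
  intro φ H hH J hJ hJq u hu hmin hus h hh hh₀ G hG A hA happ happ₀ hinv uh huh hminh hap hreg
    M₁ M₂ hM₁ hM₂
  have hs : (sobolevSeminorm Ω (m + 1) 2 (toFun u)).toReal ≤ M₂ :=
    ENNReal.toReal_le_coe_of_le_coe hM₂
  have herr : ‖u - uh‖ ≤ ↑(C₁ * M₂) * h ^ m := by
    rw [NNReal.coe_mul, mul_right_comm]
    exact hap.trans (mul_le_mul_of_nonneg_left hs (by positivity))
  have herr' : ‖u - uh‖ₑ ≤ C₁ * M₂ * ENNReal.ofReal (h ^ m) := by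
    rw [← ofReal_norm]
    refine (ENNReal.ofReal_le_ofReal herr).trans_eq ?_
    rw [ENNReal.ofReal_mul NNReal.zero_le_coe, ENNReal.ofReal_coe_nnreal, ENNReal.coe_mul]
  obtain ⟨hB, hR⟩ := hRB M₁ M₂ φ u (hH.subset_WBdry hu) hus h hh hh₀ cG CG Tref G hG A hA happ
    hinv uh huh.2 herr' hM₁ hM₂
  exact (norm_toL2_error_le hm hdm hΩ hΩb hlam hLam hH hJ hJq hu hmin hh hh₀ hA happ₀ huh hminh
    hreg herr hB hR).trans (mul_le_mul_of_nonneg_right (Real.le_coe_toNNReal _) (by positivity))
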